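/- **Setting.** Let $d\in\{2,3\}$, $\ell>0$, $\Omega=(0,\ell)^d$, and write $(\cdot,\cdot)$, $\|\cdot\|$ for the inner product and norm of $L^2=L^2(\Omega)$. Let $H^1_{\rm per}$ be the space of periodic $H^1$ functions on $\Omega$, with norm $\|v\|_{H^1_{\rm per}}^2=\|v\|^2+\|\nabla v\|^2$, and let $\mathring H^1_{\rm per}$ be its subspace of functions with mean value zero, with the norm $\|v\|_{\mathring H^1_{\rm per}}=\|\nabla v\|$, which is equivalent there. Let $M:\Omega\to\mathbb R$ be measurable with $0<M_1\le M(x)\le M_2$ for all $x\in\Omega$. For $\psi\in L^2$ let $(-\Delta_M)^{-1}\psi=w\in\mathring H^1_{\rm per}$ denote the solution of $(M\nabla w,\nabla v)=(\psi,v)$ for all $v\in\mathring H^1_{\rm per}$; write $(-\Delta)^{-1}$ when $M\equiv1$, and put $\|\psi\|_{\mathring H^{-1}_{{\rm per},M}}=((-\Delta_M)^{-1}\psi,\psi)^{1/2}$. Given $f\in L^2$ and $u_\star\in\mathring H^1_{\rm per}$, let $$G(v)=\tfrac12\|v-u_\star\|_{\mathring H^{-1}_{{\rm per},M}}^2+\tfrac14\|v\|_{L^4}^4+\tfrac12\|v\|_{\mathring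 H^1_{\rm per}}^2-(f,v),\qquad v\in\mathring H^1_{\rm per}.$$ Let $\lambda>0$, $\gamma\ge0$, $\mathcal L v=\lambda(-\Delta)^{-1}v+\gamma v-\Delta v$, and let $$\|v\|_{\mathcal L}^2=\langle\mathcal L v,v\rangle=\lambda((-\Delta)^{-1}v,v)+\gamma\|v\|^2+\|\nabla v\|^2,\qquad \|\phi\|_{\mathcal L^{-1}}=\sup_{0\ne v\in\mathring H^1_{\rm per}}\frac{\langle\phi,v\rangle}{\|v\|_{\mathcal L}}$$ for $\phi\in(\mathring H^1_{\rm per})^*$. **Constants.** $C_P>0$ is any constant with $\|v\|\le C_P\|\nabla v\|$ for all $v\in\mathring H^1_{\rm per}$. $C_3$ is any constant with $\big||a|^2a-|b|^2b\big|\le C_3|a-b|(|a|^2+|b|^2)$ for all $a,b\in\mathbb R$. $C_{emb}$ is the best constant in $\|v\|_{L^4}\le C_{emb}\|v\|_{H^1_{\rm per}}$ for $v\in H^1_{\rm per}$, and $\mathring C_{emb}$ is the best constant in $\|v\|_{L^4}\le\mathring C_{emb}\|\nabla v\|$ for $v\in\mathring H^1_{\rm per}$. For a bounded $B\subset\mathring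 H^1_{\rm per}$, $C_B=\sup_{w\in B}\|w\|_{H^1_{\rm per}}$ ($C_B=0$ if $B=\emptyset$). **Statement.** The problems defining $(-\Delta_M)^{-1}$ and $(-\Delta)^{-1}$ are uniquely solvable for every $\psi\in L^2$, and constants $C_P$, $C_{emb}$, $\mathring C_{emb}$ as above exist. $G$ is Fréchet differentiable, with derivative $\delta G$, and: 1. For every $0<r<1$, $G$ is strongly convex with constant $\mu$ with respect to the $\mathcal L$-norm: $\mu>0$ and $\langle\delta G(u)-\delta G(v),u-v\rangle\ge\mu\|u-v\|_{\mathcal L}^2$ for all $u,v\in\mathring H^1_{\rm per}$, where $$\mu=\begin{cases}\min\left\{\dfrac1{M_2\lambda},\dfrac{1-r}{\gamma C_P^2},r\right\},&\gamma>0,\\[2mm]\min\left\{\dfrac1{M_2\lambda},1\right\},&\gamma=0.\end{cases}$$ 2. $\delta G$ is locally Lipschitz continuous with respect to the $\mathcal L$-norm: for every bounded convex $B\subset\mathring H^1_{\rm per}$, $$\|\delta G(u)-\delta G(v)\|_{\mathcal L^{-1}}\le L_B\|u-v\|_{\mathcal L}\qquad\text{for all }u,v\in B,$$ both with $$L_B=\max\left\{\frac1{\lambda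 M_1},\,1+2C_3C_B^2\mathring C_{emb}^4\right\}$$ and with $$L_B=\max\left\{\frac1{\lambda M_1},\,1+2C_3C_B^2\,\kappa\,C_{emb}^4\right\},\qquad\kappa=\begin{cases}1,&\gamma\ge1,\\1+C_P^2,&0\le\gamma<1.\end{cases}$$ Both values of $L_B$ are positive. -/

import Mathlib

open MeasureTheory
open scoped ENNReal

noncomputable section

namespace CahnHilliard

/-! ### Periodic Sobolev spaces on the cube -/

/-- The open cube `(0, ℓ)^d`. -/
def cube (d : ℕ) (ℓ : ℝ) : Set (Fin d → ℝ) :=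
  Set.pi Set.univ fun _ => Set.Ioo 0 ℓ

/-- Lebesgue measure on the cube. -/
abbrev cubeMeasure (d : ℕ) (ℓ : ℝ) : Measure (Fin d → ℝ) :=
  volume.restrict (cube d ℓ)

/-- The real Hilbert space `L²` of the cube. -/
abbrev L2 (d : ℕ) (ℓ : ℝ) : Type :=
  Lp ℝ 2 (cubeMeasure d ℓ)

/-- Pairs of a function `v ∈ L²` and a vector field `g ∈ (L²)^d`, with the Hilbert norm
`(‖v‖² + ∑ i, ‖g i‖²)^(1/2)`. -/
abbrev PairSpace (d : ℕ) (ℓ : ℝ) : Type :=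
  WithLp 2 (L2 d ℓ × PiLp 2 fun _ : Fin d => L2 d ℓ)

/-- The function component of a pair. -/
def fn {d : ℕ} {ℓ : ℝ} (p : PairSpace d ℓ) : L2 d ℓ := p.fst

/-- The `i`-th component of the vector field of a pair; on the Sobolev spaces below this is the
`i`-th weak partial derivative of `fn p`. -/
def pd {d : ℕ} {ℓ : ℝ} (i : Fin d) (p : PairSpace d ℓ) : L2 d ℓ := p.snd i

/-- Test functions: smooth functions on `ℝ^d` that are `ℓ`-periodic in each coordinate. -/
def IsPeriodicTest (d : ℕ) (ℓ : ℝ) (φ : (Fin d → ℝ) → ℝ) : Prop :=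
  ContDiff ℝ (⊤ : ℕ∞) φ ∧ ∀ (i : Fin d) (x : Fin d → ℝ), φ (x + Pi.single i ℓ) = φ x

/-- The `i`-th classical partial derivative. -/
def partialDeriv {d : ℕ} (i : Fin d) (φ : (Fin d → ℝ) → ℝ) (x : Fin d → ℝ) : ℝ :=
  fderiv ℝ φ x (Pi.single i 1)

/-- `g` is the `i`-th weak partial derivative, in the periodic sense, of `v`: integration by parts
holds, without boundary terms, against every smooth periodic function. -/
def IsWeakPartial {d : ℕ} {ℓ : ℝ} (i : Fin d) (v g : L2 d ℓ) : Prop :=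
  ∀ φ : (Fin d → ℝ) → ℝ, IsPeriodicTest d ℓ φ →
    ∫ x in cube d ℓ, v x * partialDeriv i φ x = -∫ x in cube d ℓ, g x * φ x

instance (d : ℕ) (ℓ : ℝ) : IsFiniteMeasure (cubeMeasure d ℓ) := by
  refine ⟨?_⟩
  rw [Measure.restrict_apply_univ, cube, Real.volume_pi_Ioo]
  exact ENNReal.prod_lt_top fun i _ => ENNReal.ofReal_lt_top

theorem memLp_of_continuous {d : ℕ} {ℓ : ℝ} {φ : (Fin d → ℝ) → ℝ} (hφ : Continuous φ) :
    MemLp φ 2 (cubeMeasure d ℓ) := by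
  obtain ⟨C, hC⟩ := (isCompact_Icc (a := (fun _ => 0 : Fin d → ℝ))
    (b := fun _ => ℓ)).exists_bound_of_continuousOn hφ.continuousOn
  refine MemLp.of_bound hφ.aestronglyMeasurable C ?_
  have hm : MeasurableSet (cube d ℓ) := MeasurableSet.univ_pi fun _ => measurableSet_Ioo
  filter_upwards [ae_restrict_mem hm] with x hx
  refine hC x ⟨fun i => ?_, fun i => ?_⟩
  · exact (hx i (Set.mem_univ i)).1.le
  · exact (hx i (Set.mem_univ i)).2.le

theorem integrable_mul_of_continuous {d : ℕ} {ℓ : ℝ} (v : L2 d ℓ) {φ : (Fin d → ℝ) → ℝ}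
    (hφ : Continuous φ) : Integrable (fun x => v x * φ x) (cubeMeasure d ℓ) :=
  (Lp.memLp v).integrable_mul (memLp_of_continuous hφ)

theorem integral_add_mul {d : ℕ} {ℓ : ℝ} (v w : L2 d ℓ) {φ : (Fin d → ℝ) → ℝ}
    (hφ : Continuous φ) :
    ∫ x in cube d ℓ, (v + w : L2 d ℓ) x * φ x
      = (∫ x in cube d ℓ, v x * φ x) + ∫ x in cube d ℓ, w x * φ x := by
  rw [← integral_add (integrable_mul_of_continuous v hφ) (integrable_mul_of_continuous w hφ)]
  refine integral_congr_ae ?_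
  filter_upwards [Lp.coeFn_add v w] with x hx
  rw [hx, Pi.add_apply, add_mul]

theorem integral_smul_mul {d : ℕ} {ℓ : ℝ} (c : ℝ) (v : L2 d ℓ) (φ : (Fin d → ℝ) → ℝ) :
    ∫ x in cube d ℓ, (c • v : L2 d ℓ) x * φ x = c * ∫ x in cube d ℓ, v x * φ x := by
  rw [← integral_const_mul]
  refine integral_congr_ae ?_
  filter_upwards [Lp.coeFn_smul c v] with x hx
  rw [hx, Pi.smul_apply, smul_eq_mul, mul_assoc]

theorem integral_zero_mul {d : ℕ} {ℓ : ℝ} (φ : (Fin d → ℝ) → ℝ) :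
    ∫ x in cube d ℓ, (0 : L2 d ℓ) x * φ x = 0 := by
  rw [← integral_zero (Fin d → ℝ) ℝ (μ := cubeMeasure d ℓ)]
  refine integral_congr_ae ?_
  filter_upwards [Lp.coeFn_zero ℝ 2 (cubeMeasure d ℓ)] with x hx
  rw [hx, Pi.zero_apply, zero_mul]

theorem IsPeriodicTest.continuous_partialDeriv {d : ℕ} {ℓ : ℝ} {φ : (Fin d → ℝ) → ℝ}
    (hφ : IsPeriodicTest d ℓ φ) (i : Fin d) : Continuous (partialDeriv i φ) :=
  (hφ.1.continuous_fderiv (by simp)).clm_apply continuous_const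

/-- The periodic Sobolev space `H¹_per` of the cube: functions in `L²` together with their weak
gradient in `(L²)^d` (which the function determines). The inherited norm is the `H¹` norm
`(‖v‖² + ‖∇v‖²)^(1/2)`. -/
def H1per (d : ℕ) (ℓ : ℝ) : Submodule ℝ (PairSpace d ℓ) where
  carrier := {p | ∀ i, IsWeakPartial i (fn p) (pd i p)}
  add_mem' := by
    intro p q hp hq i φ hφ
    change ∫ x in cube d ℓ, (fn p + fn q : L2 d ℓ) x * partialDeriv i φ x
      = -∫ x in cube d ℓ, (pd i p + pd i q : L2 d ℓ) x * φ x
    rw [integral_add_mul _ _ (hφ.continuous_partialDeriv i),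
      integral_add_mul _ _ hφ.1.continuous, hp i φ hφ, hq i φ hφ]
    ring
  zero_mem' := by
    intro i φ _
    change ∫ x in cube d ℓ, (0 : L2 d ℓ) x * partialDeriv i φ x
      = -∫ x in cube d ℓ, (0 : L2 d ℓ) x * φ x
    rw [integral_zero_mul, integral_zero_mul, neg_zero]
  smul_mem' := by
    intro c p hp i φ hφ
    change ∫ x in cube d ℓ, (c • fn p : L2 d ℓ) x * partialDeriv i φ x
      = -∫ x in cube d ℓ, (c • pd i p : L2 d ℓ) x * φ x
    rw [integral_smul_mul, integral_smul_mul, hp i φ hφ]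
    ring

/-- The space of functions in `H¹_per` with mean value zero. It carries the `H¹` norm as its norm;
the equivalent norm `‖∇v‖` is `gradNorm` below. -/
def H1perMeanZero (d : ℕ) (ℓ : ℝ) : Submodule ℝ (PairSpace d ℓ) where
  carrier := {p | p ∈ H1per d ℓ ∧ ∫ x in cube d ℓ, fn p x = 0}
  add_mem' := by
    rintro p q ⟨hp, hp0⟩ ⟨hq, hq0⟩
    refine ⟨(H1per d ℓ).add_mem hp hq, ?_⟩
    change ∫ x in cube d ℓ, (fn p + fn q : L2 d ℓ) x = 0
    have h := integral_add_mul (fn p) (fn q) (φ := fun _ => 1) continuous_const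
    simp only [mul_one] at h
    rw [h, hp0, hq0, add_zero]
  zero_mem' := by
    refine ⟨(H1per d ℓ).zero_mem, ?_⟩
    change ∫ x in cube d ℓ, (0 : L2 d ℓ) x = 0
    simpa only [mul_one] using integral_zero_mul (d := d) (ℓ := ℓ) fun _ => 1
  smul_mem' := by
    rintro c p ⟨hp, hp0⟩
    refine ⟨(H1per d ℓ).smul_mem c hp, ?_⟩
    change ∫ x in cube d ℓ, (c • fn p : L2 d ℓ) x = 0
    have h := integral_smul_mul c (fn p) fun _ => 1
    simp only [mul_one] at h
    rw [h, hp0, mul_zero]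

/-- The Dirichlet form `(∇p, ∇q) = ∑ i, (∂ᵢ p, ∂ᵢ q)`. -/
def gradInner {d : ℕ} {ℓ : ℝ} (p q : PairSpace d ℓ) : ℝ :=
  ∑ i, inner ℝ (pd i p) (pd i q)

/-- The norm `‖∇p‖`. -/
def gradNorm {d : ℕ} {ℓ : ℝ} (p : PairSpace d ℓ) : ℝ := √(gradInner p p)

/-! ### Poincaré and embedding constants -/

/-- `C` is a constant in the Poincaré inequality for periodic functions of mean zero. -/
def IsPoincareConst (d : ℕ) (ℓ C : ℝ) : Prop :=
  0 < C ∧ ∀ v : H1perMeanZero d ℓ, ‖fn v.1‖ ≤ C * gradNorm v.1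

/-- `C` is the best constant in the embedding of `H¹_per`, with the `H¹` norm, into `L⁴`. -/
def IsBestEmbConst (d : ℕ) (ℓ C : ℝ) : Prop :=
  IsLeast {K : ℝ | 0 ≤ K ∧ ∀ v : H1per d ℓ,
    eLpNorm (fn v.1) 4 (cubeMeasure d ℓ) ≤ ENNReal.ofReal (K * ‖v‖)} C

/-- `C` is the best constant in the embedding into `L⁴` of the mean zero functions in `H¹_per`,
with the norm `‖∇v‖`. -/
def IsBestEmbConstMeanZero (d : ℕ) (ℓ C : ℝ) : Prop :=
  IsLeast {K : ℝ | 0 ≤ K ∧ ∀ v : H1perMeanZero d ℓ,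
    eLpNorm (fn v.1) 4 (cubeMeasure d ℓ) ≤ ENNReal.ofReal (K * gradNorm v.1)} C

/-! ### The elliptic operators and the energy -/

/-- `w` is the weak solution, periodic and of mean zero, of `-∇ · (M ∇w) = ψ`. -/
def IsWeakSol {d : ℕ} {ℓ : ℝ} (M : (Fin d → ℝ) → ℝ) (ψ : L2 d ℓ) (w : H1perMeanZero d ℓ) : Prop :=
  ∀ v : H1perMeanZero d ℓ,
    ∑ i, ∫ x in cube d ℓ, M x * pd i w.1 x * pd i v.1 x = inner ℝ ψ (fn v.1)

/-- The solution operator `(-Δ_M)⁻¹`. It selects the weak solution, which exists and is unique when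
`M` is measurable and lies between two positive constants. -/
def invLap {d : ℕ} {ℓ : ℝ} (M : (Fin d → ℝ) → ℝ) (ψ : L2 d ℓ) : H1perMeanZero d ℓ :=
  Classical.epsilon (IsWeakSol M ψ)

/-- The negative norm `((-Δ_M)⁻¹ ψ, ψ)^(1/2)`. -/
def negNorm {d : ℕ} {ℓ : ℝ} (M : (Fin d → ℝ) → ℝ) (ψ : L2 d ℓ) : ℝ :=
  √(inner ℝ (fn (invLap M ψ).1) ψ)

/-- The stationary Cahn-Hilliard energy. -/
def energy {d : ℕ} {ℓ : ℝ} (M : (Fin d → ℝ) → ℝ) (f : L2 d ℓ) (ustar : H1perMeanZero d ℓ)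
    (v : H1perMeanZero d ℓ) : ℝ :=
  1 / 2 * negNorm M (fn (v - ustar).1) ^ 2 + 1 / 4 * (∫ x in cube d ℓ, |fn v.1 x| ^ 4)
    + 1 / 2 * gradNorm v.1 ^ 2 - inner ℝ f (fn v.1)

/-- The bilinear form `⟨𝓛 u, v⟩` of the preconditioner `𝓛 = lam (-Δ)⁻¹ + gam - Δ`. -/
def precondForm {d : ℕ} {ℓ : ℝ} (lam gam : ℝ) (u v : H1perMeanZero d ℓ) : ℝ :=
  lam * inner ℝ (fn (invLap (fun _ => 1) (fn u.1)).1) (fn v.1)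
    + gam * inner ℝ (fn u.1) (fn v.1) + gradInner u.1 v.1

/-- The `𝓛`-norm `⟨𝓛 v, v⟩^(1/2)`. -/
def precondNorm {d : ℕ} {ℓ : ℝ} (lam gam : ℝ) (v : H1perMeanZero d ℓ) : ℝ :=
  √(precondForm lam gam v v)

/-! ### Strong convexity and locally Lipschitz derivatives with respect to a given norm -/

/-- `G` is `mu`-strongly convex with respect to the norm `N`. -/
def StronglyConvexWrt {H : Type*} [NormedAddCommGroup H] [NormedSpace ℝ H] (N : H → ℝ) (mu : ℝ)
    (G : H → ℝ) : Prop :=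
  0 < mu ∧ Differentiable ℝ G ∧
    ∀ u v : H, mu * N (u - v) ^ 2 ≤ (fderiv ℝ G u - fderiv ℝ G v) (u - v)

/-- The dual norm `sup_{v ≠ 0} ⟨φ, v⟩ / N v`, with values in `[0, ∞]`. -/
def dualNorm {H : Type*} [NormedAddCommGroup H] [NormedSpace ℝ H] (N : H → ℝ)
    (φ : H →L[ℝ] ℝ) : ℝ≥0∞ :=
  ⨆ (v : H) (_ : v ≠ 0), ENNReal.ofReal (φ v / N v)

/-- `G` is differentiable and its derivative is Lipschitz continuous with respect to the norm `N`
on every bounded convex set `B`, with constant `L B > 0`. -/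
def LocallyLipschitzDerivWrt {H : Type*} [NormedAddCommGroup H] [NormedSpace ℝ H] (N : H → ℝ)
    (L : Set H → ℝ) (G : H → ℝ) : Prop :=
  Differentiable ℝ G ∧ ∀ B : Set H, Bornology.IsBounded B → Convex ℝ B →
    0 < L B ∧ ∀ u ∈ B, ∀ v ∈ B,
      dualNorm N (fderiv ℝ G u - fderiv ℝ G v) ≤ ENNReal.ofReal (L B * N (u - v))

/-- `sup_{w ∈ B} ‖w‖`, with the `H¹` norm. -/
def supH1 {d : ℕ} {ℓ : ℝ} (B : Set (H1perMeanZero d ℓ)) : ℝ :=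
  sSup ((fun w => ‖w‖) '' B)

/-- The strong convexity constant. -/
def convexityConst (M₂ lam gam CP r : ℝ) : ℝ :=
  if 0 < gam then min (1 / (M₂ * lam)) (min ((1 - r) / (gam * CP ^ 2)) r)
  else min (1 / (M₂ * lam)) 1

/-- The Lipschitz constant `max {1 / (lam M₁), 1 + 2 C₃ CB² K⁴}`, where `K4` stands for `K⁴`. -/
def lipConst (M₁ lam C₃ CB K4 : ℝ) : ℝ :=
  max (1 / (lam * M₁)) (1 + 2 * C₃ * CB ^ 2 * K4)

/-- `C` is a constant in the inequality `||a|²a - |b|²b| ≤ C |a - b| (|a|² + |b|²)`. -/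
def IsCubicDiffConst (C : ℝ) : Prop :=
  ∀ a b : ℝ, |(|a| ^ 2 * a - |b| ^ 2 * b)| ≤ C * |a - b| * (|a| ^ 2 + |b| ^ 2)

end CahnHilliard

end

open CahnHilliard

noncomputable section

namespace CahnHilliard

/-! ### Fourier series on the torus and on the cube -/

section Torus

open UnitAddTorus

local instance instMeasureSpaceUnitAddCircleHaar : MeasureSpace UnitAddCircle :=
  ⟨AddCircle.haarAddCircle⟩

local instance instIsAddHaarMeasureUnitAddCircle :
    Measure.IsAddHaarMeasure (volume : Measure UnitAddCircle) :=
  inferInstanceAs (Measure.IsAddHaarMeasure AddCircle.haarAddCircle)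

local instance instIsProbabilityMeasureUnitAddCircle :
    IsProbabilityMeasure (volume : Measure UnitAddCircle) :=
  inferInstanceAs (IsProbabilityMeasure AddCircle.haarAddCircle)

/-- The squared Japanese bracket `1 + |k|²` of a frequency. -/
def freqWeight {d : ℕ} (k : Fin d → ℤ) : ℝ := 1 + ∑ i, (k i : ℝ) ^ 2

theorem one_le_freqWeight {d : ℕ} (k : Fin d → ℤ) : 1 ≤ freqWeight k :=
  le_add_of_nonneg_right (Finset.sum_nonneg fun _ _ => sq_nonneg _)

theorem freqWeight_pos {d : ℕ} (k : Fin d → ℤ) : 0 < freqWeight k :=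
  zero_lt_one.trans_le (one_le_freqWeight k)

theorem summable_freqWeight_inv_sq {d : ℕ} (hd : d < 4) :
    Summable fun k : Fin d → ℤ => (freqWeight k)⁻¹ ^ 2 := by
  let b := Pi.basisFun ℝ (Fin d)
  let Λ : Submodule ℤ (Fin d → ℝ) := Submodule.span ℤ (Set.range b)
  have hrank : Module.finrank ℤ Λ = d := by
    rw [ZLattice.rank ℝ Λ]; simp
  have hs := ZLattice.summable_norm_pow_inv Λ 4 (by rw [hrank]; exact hd)
  have hmem : ∀ k : Fin d → ℤ, (fun i => (k i : ℝ)) ∈ Λ := by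
    intro k
    have : (fun i => (k i : ℝ)) = ∑ i, k i • b i := by
      ext j
      simp [b, Finset.sum_apply, Pi.single_apply]
    rw [this]
    exact Submodule.sum_mem _ fun i _ =>
      Submodule.smul_mem _ _ (Submodule.subset_span ⟨i, rfl⟩)
  let e : (Fin d → ℤ) → Λ := fun k => ⟨_, hmem k⟩
  have he : Function.Injective e := by
    intro k m h
    ext i
    have : (k i : ℝ) = m i := congrFun (congrArg Subtype.val h) i
    exact_mod_cast this
  refine Summable.of_norm_bounded_eventually (hs.comp_injective he) ?_
  have h0 : ∀ᶠ k : Fin d → ℤ in Filter.cofinite, k ≠ 0 := by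
    simp
  filter_upwards [h0] with k hk
  have hpos : 0 < ‖e k‖ := by
    rw [norm_pos_iff]
    intro h
    apply hk
    apply he
    rw [h]
    ext i
    simp [e]
  have hle : ‖e k‖ ^ 2 ≤ freqWeight k := by
    have h1 : ‖e k‖ ≤ √(∑ i, (k i : ℝ) ^ 2) := by
      change ‖(fun i => (k i : ℝ))‖ ≤ _
      refine (pi_norm_le_iff_of_nonneg (Real.sqrt_nonneg _)).2 fun i => ?_
      rw [Real.norm_eq_abs]
      refine Real.le_sqrt_of_sq_le ?_
      rw [sq_abs]
      exact Finset.single_le_sum (f := fun i => (k i : ℝ) ^ 2) (fun _ _ => sq_nonneg _)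
        (Finset.mem_univ i)
    calc ‖e k‖ ^ 2 ≤ √(∑ i, (k i : ℝ) ^ 2) ^ 2 := by gcongr
      _ = ∑ i, (k i : ℝ) ^ 2 := Real.sq_sqrt (Finset.sum_nonneg fun _ _ => sq_nonneg _)
      _ ≤ freqWeight k := by rw [freqWeight]; linarith
  rw [Real.norm_of_nonneg (by have := freqWeight_pos k; positivity)]
  change (freqWeight k)⁻¹ ^ 2 ≤ ‖e k‖⁻¹ ^ 4
  have : ‖e k‖⁻¹ ^ 4 = ((‖e k‖ ^ 2)⁻¹) ^ 2 := by rw [inv_pow, inv_pow, ← pow_mul]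
  rw [this]
  have := freqWeight_pos k
  gcongr

theorem coeFn_sum_mFourierLp {d : ℕ} (F : Finset (Fin d → ℤ)) (b : (Fin d → ℤ) → ℂ) :
    ((∑ k ∈ F, b k • mFourierLp (d := Fin d) 2 k : Lp ℂ 2 volume) : UnitAddTorus (Fin d) → ℂ)
      =ᵐ[volume] fun t => ∑ k ∈ F, b k * mFourier k t := by
  have h3 : ∀ᵐ t : UnitAddTorus (Fin d), ∀ k ∈ F,
      (b k • mFourierLp (d := Fin d) 2 k : Lp ℂ 2 volume) t = b k * mFourier k t := by
    rw [Filter.eventually_all_finset]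
    intro k _
    filter_upwards [Lp.coeFn_smul (b k) (mFourierLp (d := Fin d) 2 k), coeFn_mFourierLp 2 k]
      with t h h'
    rw [h, Pi.smul_apply, h', smul_eq_mul]
  filter_upwards [Lp.coeFn_finsetSum F fun k => b k • mFourierLp (d := Fin d) 2 k, h3]
    with t h h'
  rw [h, Finset.sum_apply]
  exact Finset.sum_congr rfl fun k hk => h' k hk

theorem integral_normSq_sum_mFourier {d : ℕ} (F : Finset (Fin d → ℤ)) (b : (Fin d → ℤ) → ℂ) :
    ∫ t : UnitAddTorus (Fin d), ‖∑ k ∈ F, b k * mFourier k t‖ ^ 2 = ∑ k ∈ F, ‖b k‖ ^ 2 := by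
  have h1 := (orthonormal_mFourier (d := Fin d)).inner_sum b b F
  have h2 := coeFn_sum_mFourierLp F b
  have h4 : (∫ t : UnitAddTorus (Fin d), ‖∑ k ∈ F, b k * mFourier k t‖ ^ 2)
      = ‖∑ k ∈ F, b k • mFourierLp (d := Fin d) 2 k‖ ^ 2 := by
    rw [← inner_self_eq_norm_sq (𝕜 := ℂ), L2.inner_def, ← integral_re (L2.integrable_inner _ _)]
    refine integral_congr_ae ?_
    filter_upwards [h2] with t ht
    rw [ht, inner_self_eq_norm_sq]
  rw [h4, ← inner_self_eq_norm_sq (𝕜 := ℂ), h1, map_sum]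
  refine Finset.sum_congr rfl fun k _ => ?_
  rw [RCLike.conj_mul]
  norm_cast

/-- The Sobolev embedding into `L⁴` for trigonometric polynomials: Cauchy-Schwarz for the
convolution of the coefficients. -/
theorem integral_pow_four_sum_mFourier_le {d : ℕ} (hd : d < 4) (F : Finset (Fin d → ℤ))
    (a : (Fin d → ℤ) → ℂ) :
    ∫ t : UnitAddTorus (Fin d), ‖∑ k ∈ F, a k * mFourier k t‖ ^ 4
      ≤ (∑' k : Fin d → ℤ, (freqWeight k)⁻¹ ^ 2) * (∑ k ∈ F, freqWeight k * ‖a k‖ ^ 2) ^ 2 := by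
  classical
  set S := ∑' k : Fin d → ℤ, (freqWeight k)⁻¹ ^ 2 with hS
  set P := F ×ˢ F with hP
  set E := P.image fun p => p.1 + p.2 with hE
  set b : (Fin d → ℤ) → ℂ := fun k => ∑ p ∈ P with p.1 + p.2 = k, a p.1 * a p.2 with hb
  have hmaps : ∀ p ∈ P, p.1 + p.2 ∈ E := fun p hp => Finset.mem_image_of_mem _ hp
  have hsq : ∀ t : UnitAddTorus (Fin d), (∑ k ∈ F, a k * mFourier k t) ^ 2
      = ∑ k ∈ E, b k * mFourier k t := by
    intro t
    rw [sq, Finset.sum_mul_sum, ← Finset.sum_product', ← Finset.sum_fiberwise_of_maps_to hmaps]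
    refine Finset.sum_congr rfl fun k _ => ?_
    rw [hb, Finset.sum_mul]
    refine Finset.sum_congr rfl fun p hp => ?_
    rw [← (Finset.mem_filter.1 hp).2, mFourier_add]
    ring
  have hint : ∫ t : UnitAddTorus (Fin d), ‖∑ k ∈ F, a k * mFourier k t‖ ^ 4
      = ∑ k ∈ E, ‖b k‖ ^ 2 := by
    rw [← integral_normSq_sum_mFourier]
    congr 1
    ext t
    rw [← hsq, norm_pow, ← pow_mul]
  have hbk : ∀ k ∈ E, ‖b k‖ ^ 2 ≤ S * ∑ p ∈ P with p.1 + p.2 = k,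
      (freqWeight p.1 * ‖a p.1‖ ^ 2) * (freqWeight p.2 * ‖a p.2‖ ^ 2) := by
    intro k _
    have hS' : ∑ p ∈ P with p.1 + p.2 = k, (freqWeight p.1)⁻¹ * (freqWeight p.2)⁻¹ ≤ S := by
      have i1 : ∑ p ∈ P with p.1 + p.2 = k, (freqWeight p.1)⁻¹ ^ 2 ≤ S := by
        rw [← Finset.sum_image (s := P.filter fun p => p.1 + p.2 = k) (g := Prod.fst)
          (f := fun m => (freqWeight m)⁻¹ ^ 2)]
        · exact (summable_freqWeight_inv_sq hd).sum_le_tsum _ fun _ _ => sq_nonneg _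
        · intro p hp q hq h
          have h1 := (Finset.mem_filter.1 hp).2
          have h2 := (Finset.mem_filter.1 hq).2
          refine Prod.ext h ?_
          rw [← h2, h] at h1
          exact add_left_cancel h1
      have i2 : ∑ p ∈ P with p.1 + p.2 = k, (freqWeight p.2)⁻¹ ^ 2 ≤ S := by
        rw [← Finset.sum_image (s := P.filter fun p => p.1 + p.2 = k) (g := Prod.snd)
          (f := fun m => (freqWeight m)⁻¹ ^ 2)]
        · exact (summable_freqWeight_inv_sq hd).sum_le_tsum _ fun _ _ => sq_nonneg _
        · intro p hp q hq h
          have h1 := (Finset.mem_filter.1 hp).2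
          have h2 := (Finset.mem_filter.1 hq).2
          refine Prod.ext ?_ h
          rw [← h2, h] at h1
          exact add_right_cancel h1
      calc ∑ p ∈ P with p.1 + p.2 = k, (freqWeight p.1)⁻¹ * (freqWeight p.2)⁻¹
          ≤ ∑ p ∈ P with p.1 + p.2 = k,
            (1 / 2 * (freqWeight p.1)⁻¹ ^ 2 + 1 / 2 * (freqWeight p.2)⁻¹ ^ 2) := by
            refine Finset.sum_le_sum fun p _ => ?_
            nlinarith [sq_nonneg ((freqWeight p.1)⁻¹ - (freqWeight p.2)⁻¹)]
        _ ≤ S := by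
            rw [Finset.sum_add_distrib, ← Finset.mul_sum, ← Finset.mul_sum]
            linarith
    have hcs := Finset.sum_sq_le_sum_mul_sum_of_sq_le_mul (P.filter fun p => p.1 + p.2 = k)
      (r := fun p => ‖a p.1‖ * ‖a p.2‖) (f := fun p => (freqWeight p.1)⁻¹ * (freqWeight p.2)⁻¹)
      (g := fun p => (freqWeight p.1 * ‖a p.1‖ ^ 2) * (freqWeight p.2 * ‖a p.2‖ ^ 2))
      (fun p _ => by have := freqWeight_pos p.1; have := freqWeight_pos p.2; positivity)
      (fun p _ => by have := freqWeight_pos p.1; have := freqWeight_pos p.2; positivity)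
      (fun p _ => by
        have := (freqWeight_pos p.1).ne'
        have := (freqWeight_pos p.2).ne'
        exact le_of_eq (by field_simp))
    have hn : ‖b k‖ ≤ ∑ p ∈ P with p.1 + p.2 = k, ‖a p.1‖ * ‖a p.2‖ := by
      refine (norm_sum_le _ _).trans_eq (Finset.sum_congr rfl fun p _ => norm_mul _ _)
    refine (pow_le_pow_left₀ (norm_nonneg _) hn 2).trans (hcs.trans ?_)
    refine mul_le_mul_of_nonneg_right hS' (Finset.sum_nonneg fun p _ => ?_)
    have := freqWeight_pos p.1
    have := freqWeight_pos p.2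
    positivity
  rw [hint]
  refine (Finset.sum_le_sum hbk).trans_eq ?_
  rw [← Finset.mul_sum, Finset.sum_fiberwise_of_maps_to hmaps, sq, Finset.sum_mul_sum,
    ← Finset.sum_product']

theorem eLpNorm_four_le_of_integral_le {α : Type*} [MeasurableSpace α] {μ : Measure α}
    {f : α → ℂ} (hint : Integrable (fun x => ‖f x‖ ^ 4) μ)
    {R : ℝ} (hR : 0 ≤ R) (h : ∫ x, ‖f x‖ ^ 4 ∂μ ≤ R ^ 4) : eLpNorm f 4 μ ≤ ENNReal.ofReal R := by
  have h1 : eLpNorm f 4 μ ^ (4 : ℝ) = ∫⁻ x, ‖f x‖ₑ ^ (4 : ℝ) ∂μ := by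
    have := eLpNorm_nnreal_pow_eq_lintegral (p := 4) (f := f) (μ := μ) (by norm_num)
    simpa using this
  have h2 : ∫⁻ x, ‖f x‖ₑ ^ (4 : ℝ) ∂μ = ENNReal.ofReal (∫ x, ‖f x‖ ^ 4 ∂μ) := by
    rw [ofReal_integral_eq_lintegral_ofReal hint (Filter.Eventually.of_forall fun _ => by positivity)]
    congr 1
    ext x
    rw [ENNReal.ofReal_pow (norm_nonneg _), ofReal_norm]
    norm_cast
  rw [← ENNReal.rpow_le_rpow_iff (z := 4) (by norm_num), h1, h2]
  refine (ENNReal.ofReal_le_ofReal h).trans_eq ?_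
  rw [ENNReal.ofReal_pow hR]
  norm_cast

/-- The Sobolev embedding into `L⁴` on the torus of dimension at most three. -/
theorem eLpNorm_four_le_of_mFourierCoeff {d : ℕ} (hd : d < 4)
    (V : Lp ℂ 2 (volume : Measure (UnitAddTorus (Fin d)))) {A : ℝ} (hA : 0 ≤ A)
    (h : ∀ F : Finset (Fin d → ℤ), ∑ k ∈ F, freqWeight k * ‖mFourierCoeff V k‖ ^ 2 ≤ A ^ 2) :
    eLpNorm V 4 volume
      ≤ ENNReal.ofReal ((∑' k : Fin d → ℤ, (freqWeight k)⁻¹ ^ 2) ^ (1 / 4 : ℝ) * A) := by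
  set S := ∑' k : Fin d → ℤ, (freqWeight k)⁻¹ ^ 2 with hS
  have hS0 : 0 ≤ S := tsum_nonneg fun _ => sq_nonneg _
  set p : Finset (Fin d → ℤ) → Lp ℂ 2 (volume : Measure (UnitAddTorus (Fin d))) :=
    fun F => ∑ k ∈ F, mFourierCoeff V k • mFourierLp 2 k with hp
  have hpc := fun F => coeFn_sum_mFourierLp F (mFourierCoeff V)
  have hbound : ∀ F, eLpNorm (p F) 4 volume ≤ ENNReal.ofReal (S ^ (1 / 4 : ℝ) * A) := by
    intro F
    rw [eLpNorm_congr_ae (hpc F)]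
    have hc : Continuous fun t : UnitAddTorus (Fin d) =>
        ∑ k ∈ F, mFourierCoeff V k * mFourier k t := by fun_prop
    refine eLpNorm_four_le_of_integral_le ?_ (by positivity) ?_
    · exact (hc.norm.pow 4).integrable_of_hasCompactSupport
        (HasCompactSupport.of_compactSpace _)
    · refine (integral_pow_four_sum_mFourier_le hd F _).trans ?_
      have : (S ^ (1 / 4 : ℝ) * A) ^ 4 = S * (A ^ 2) ^ 2 := by
        rw [mul_pow, ← Real.rpow_natCast, ← Real.rpow_mul hS0, ← pow_mul]
        norm_num
      rw [this]
      have h0 : 0 ≤ ∑ k ∈ F, freqWeight k * ‖mFourierCoeff V k‖ ^ 2 :=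
        Finset.sum_nonneg fun k _ => by have := freqWeight_pos k; positivity
      exact mul_le_mul_of_nonneg_left (pow_le_pow_left₀ h0 (h F) 2) hS0
  obtain ⟨F, hF⟩ := Filter.exists_seq_tendsto
    (Filter.atTop : Filter (Finset (Fin d → ℤ)))
  have hlim : Filter.Tendsto (fun n => p (F n)) Filter.atTop (nhds V) :=
    (hasSum_mFourier_series_L2 V).comp hF
  obtain ⟨ns, -, hns⟩ := (tendstoInMeasure_of_tendsto_Lp hlim).exists_seq_tendsto_ae
  refine (Lp.eLpNorm_lim_le_liminf_eLpNorm (fun n => (Lp.aestronglyMeasurable (p (F (ns n)))))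
    V hns).trans ?_
  exact Filter.liminf_le_of_frequently_le'
    (Filter.Frequently.of_forall fun n => hbound (F (ns n)))

/-- The map from the torus to the cube of side `ℓ` that inverts `x ↦ x / ℓ mod 1`. -/
def torusSection {d : ℕ} (ℓ : ℝ) (t : UnitAddTorus (Fin d)) : Fin d → ℝ :=
  ℓ • (measurableEquivPiIoc (fun _ : Fin d => (0 : ℝ)) t).1

/-- The density of the normalized measure of the cube. -/
def invVol (d : ℕ) (ℓ : ℝ) : ℝ := (ℓ ^ d)⁻¹

theorem invVol_pos {d : ℕ} {ℓ : ℝ} (hℓ : 0 < ℓ) : 0 < invVol d ℓ := by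
  unfold invVol; positivity

theorem measurePreserving_torusSection {d : ℕ} {ℓ : ℝ} (hℓ : 0 < ℓ) :
    MeasurePreserving (torusSection (d := d) ℓ) volume
      (ENNReal.ofReal (invVol d ℓ) • cubeMeasure d ℓ) := by
  have h1 := measurePreserving_equivPiIoc (fun _ : Fin d => (0 : ℝ))
  have hm : MeasurableSet {x : Fin d → ℝ | ∀ i, x i ∈ Set.Ioc (0 : ℝ) (0 + 1)} :=
    MeasurableSet.univ_pi' fun i => measurableSet_Ioc
  refine ⟨(measurable_const_smul ℓ).comp (measurable_subtype_coe.comp h1.measurable), ?_⟩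
  have e1 : (torusSection (d := d) ℓ) = (fun x => ℓ • x) ∘ Subtype.val ∘
      (measurableEquivPiIoc (fun _ : Fin d => (0 : ℝ))) := rfl
  rw [e1, ← Measure.map_map (measurable_const_smul ℓ)
    (measurable_subtype_coe.comp h1.measurable),
    ← Measure.map_map measurable_subtype_coe h1.measurable, h1.map_eq]
  have e0 : Measure.map Subtype.val (Measure.comap
      (Subtype.val : {x : Fin d → ℝ // ∀ i, x i ∈ Set.Ioc (0 : ℝ) (0 + 1)} → Fin d → ℝ) volume)
      = volume.restrict {x : Fin d → ℝ | ∀ i, x i ∈ Set.Ioc (0 : ℝ) (0 + 1)} :=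
    map_comap_subtype_coe hm volume
  rw [e0]
  have e2 : ((fun x : Fin d → ℝ => ℓ • x) ⁻¹' {x | ∀ i, x i ∈ Set.Ioc (0 : ℝ) ℓ})
      = {x : Fin d → ℝ | ∀ i, x i ∈ Set.Ioc (0 : ℝ) (0 + 1)} := by
    ext x
    simp only [Set.mem_preimage, Set.mem_ofPred_eq, Pi.smul_apply, smul_eq_mul, Set.mem_Ioc,
      zero_add]
    refine forall_congr' fun i => ?_
    rw [mul_pos_iff_of_pos_left hℓ, mul_le_iff_le_one_right hℓ]
  have hm' : MeasurableSet {x : Fin d → ℝ | ∀ i, x i ∈ Set.Ioc (0 : ℝ) ℓ} :=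
    MeasurableSet.univ_pi' fun i => measurableSet_Ioc
  rw [← e2, ← Measure.restrict_map (measurable_const_smul ℓ) hm',
    Measure.map_addHaar_smul _ hℓ.ne', Measure.restrict_smul]
  have e3 : {x : Fin d → ℝ | ∀ i, x i ∈ Set.Ioc (0 : ℝ) ℓ}
      = Set.pi Set.univ fun _ => Set.Ioc (0 : ℝ) ℓ := by ext; simp
  have e4 : (volume : Measure (Fin d → ℝ)).restrict (cube d ℓ)
      = volume.restrict (Set.pi Set.univ fun _ => Set.Ioc (0 : ℝ) ℓ) := by
    refine Measure.restrict_congr_set ?_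
    exact Measure.univ_pi_Ioo_ae_eq_Icc.trans Measure.univ_pi_Ioc_ae_eq_Icc.symm
  rw [e3, cubeMeasure, e4]
  congr 2
  rw [Module.finrank_fin_fun, abs_of_pos (by positivity), invVol]

/-- The phase `2π k · x / ℓ`. -/
def phase {d : ℕ} (ℓ : ℝ) (k : Fin d → ℤ) (x : Fin d → ℝ) : ℝ :=
  ∑ i, 2 * Real.pi * k i / ℓ * x i

theorem mFourier_eq_exp_phase {d : ℕ} {ℓ : ℝ} (hℓ : 0 < ℓ) (k : Fin d → ℤ)
    (t : UnitAddTorus (Fin d)) :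
    mFourier k t = Complex.exp (phase ℓ k (torusSection ℓ t) * Complex.I) := by
  have ht : ∀ i, t i = (((AddCircle.equivIoc 1 (0 : ℝ) (t i)).1 : ℝ) : UnitAddCircle) := fun i =>
    ((AddCircle.equivIoc 1 (0 : ℝ)).symm_apply_apply (t i)).symm
  have h1 : mFourier k t = ∏ i, fourier (k i) (t i) := rfl
  rw [h1, phase, Complex.ofReal_sum, Finset.sum_mul, Complex.exp_sum]
  refine Finset.prod_congr rfl fun i _ => ?_
  conv_lhs => rw [ht i]
  rw [fourier_coe_apply]
  congr 1
  have h2 : torusSection ℓ t i = ℓ * (AddCircle.equivIoc 1 (0 : ℝ) (t i)).1 := rfl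
  rw [h2]
  have : (ℓ : ℂ) ≠ 0 := by exact_mod_cast hℓ.ne'
  push_cast
  field_simp

theorem contDiff_phase {d : ℕ} (ℓ : ℝ) (k : Fin d → ℤ) : ContDiff ℝ (⊤ : ℕ∞) (phase ℓ k) := by
  unfold phase
  fun_prop

theorem phase_add_single {d : ℕ} (ℓ : ℝ) (k : Fin d → ℤ) (x : Fin d → ℝ) (i : Fin d) (c : ℝ) :
    phase ℓ k (x + Pi.single i c) = phase ℓ k x + 2 * Real.pi * k i / ℓ * c := by
  simp only [phase, Pi.add_apply, mul_add, Finset.sum_add_distrib]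
  congr 1
  rw [Finset.sum_eq_single i] <;> simp +contextual

theorem fderiv_phase_single {d : ℕ} (ℓ : ℝ) (k : Fin d → ℤ) (x : Fin d → ℝ) (i : Fin d) :
    fderiv ℝ (phase ℓ k) x (Pi.single i 1) = 2 * Real.pi * k i / ℓ := by
  have h : HasFDerivAt (phase ℓ k)
      (∑ j, (2 * Real.pi * k j / ℓ) • (ContinuousLinearMap.proj j : (Fin d → ℝ) →L[ℝ] ℝ)) x := by
    unfold phase
    refine HasFDerivAt.fun_sum fun j _ => ?_
    exact (ContinuousLinearMap.proj j : (Fin d → ℝ) →L[ℝ] ℝ).hasFDerivAt.const_mul _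
  rw [h.fderiv, sum_apply, Finset.sum_eq_single i]
  · simp
  · intro j _ hj
    simp [hj]
  · simp

theorem phase_add_single_period {d : ℕ} {ℓ : ℝ} (hℓ : 0 < ℓ) (k : Fin d → ℤ) (x : Fin d → ℝ)
    (i : Fin d) : phase ℓ k (x + Pi.single i ℓ) = phase ℓ k x + k i * (2 * Real.pi) := by
  rw [phase_add_single]
  field_simp

theorem isPeriodicTest_cos_phase {d : ℕ} {ℓ : ℝ} (hℓ : 0 < ℓ) (k : Fin d → ℤ) :
    IsPeriodicTest d ℓ fun x => Real.cos (phase ℓ k x) :=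
  ⟨Real.contDiff_cos.comp (contDiff_phase ℓ k), fun i x => by
    simp only [phase_add_single_period hℓ, Real.cos_add_int_mul_two_pi]⟩

theorem isPeriodicTest_sin_phase {d : ℕ} {ℓ : ℝ} (hℓ : 0 < ℓ) (k : Fin d → ℤ) :
    IsPeriodicTest d ℓ fun x => Real.sin (phase ℓ k x) :=
  ⟨Real.contDiff_sin.comp (contDiff_phase ℓ k), fun i x => by
    simp only [phase_add_single_period hℓ, Real.sin_add_int_mul_two_pi]⟩

theorem partialDeriv_cos_phase {d : ℕ} (ℓ : ℝ) (k : Fin d → ℤ) (i : Fin d) (x : Fin d → ℝ) :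
    partialDeriv i (fun x => Real.cos (phase ℓ k x)) x
      = -(2 * Real.pi * k i / ℓ) * Real.sin (phase ℓ k x) := by
  have h := ((contDiff_phase ℓ k).differentiable (by simp) x).hasFDerivAt.cos
  rw [partialDeriv, h.fderiv, smul_apply, fderiv_phase_single, smul_eq_mul]
  ring

theorem partialDeriv_sin_phase {d : ℕ} (ℓ : ℝ) (k : Fin d → ℤ) (i : Fin d) (x : Fin d → ℝ) :
    partialDeriv i (fun x => Real.sin (phase ℓ k x)) x
      = (2 * Real.pi * k i / ℓ) * Real.cos (phase ℓ k x) := by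
  have h := ((contDiff_phase ℓ k).differentiable (by simp) x).hasFDerivAt.sin
  rw [partialDeriv, h.fderiv, smul_apply, fderiv_phase_single, smul_eq_mul]
  ring

/-- The cosine coefficient of `v` at the frequency `k`. -/
def cosCoeff {d : ℕ} {ℓ : ℝ} (v : L2 d ℓ) (k : Fin d → ℤ) : ℝ :=
  ∫ x in cube d ℓ, v x * Real.cos (phase ℓ k x)

/-- The sine coefficient of `v` at the frequency `k`. -/
def sinCoeff {d : ℕ} {ℓ : ℝ} (v : L2 d ℓ) (k : Fin d → ℤ) : ℝ :=
  ∫ x in cube d ℓ, v x * Real.sin (phase ℓ k x)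

theorem IsWeakPartial.cosCoeff_sq_add_sinCoeff_sq {d : ℕ} {ℓ : ℝ} (hℓ : 0 < ℓ) {i : Fin d}
    {v g : L2 d ℓ} (h : IsWeakPartial i v g) (k : Fin d → ℤ) :
    cosCoeff g k ^ 2 + sinCoeff g k ^ 2
      = (2 * Real.pi * k i / ℓ) ^ 2 * (cosCoeff v k ^ 2 + sinCoeff v k ^ 2) := by
  have h1 := h _ (isPeriodicTest_cos_phase hℓ k)
  have h2 := h _ (isPeriodicTest_sin_phase hℓ k)
  simp only [partialDeriv_cos_phase, partialDeriv_sin_phase] at h1 h2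
  have e1 : ∫ x in cube d ℓ, v x * (-(2 * Real.pi * k i / ℓ) * Real.sin (phase ℓ k x))
      = -(2 * Real.pi * k i / ℓ) * sinCoeff v k := by
    rw [sinCoeff, ← integral_const_mul]
    congr 1; ext x; ring
  have e2 : ∫ x in cube d ℓ, v x * ((2 * Real.pi * k i / ℓ) * Real.cos (phase ℓ k x))
      = (2 * Real.pi * k i / ℓ) * cosCoeff v k := by
    rw [cosCoeff, ← integral_const_mul]
    congr 1; ext x; ring
  rw [e1] at h1
  rw [e2] at h2
  have h3 : cosCoeff g k = (2 * Real.pi * k i / ℓ) * sinCoeff v k := by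
    rw [cosCoeff]; linarith
  have h4 : sinCoeff g k = -((2 * Real.pi * k i / ℓ) * cosCoeff v k) := by
    rw [sinCoeff]; linarith
  rw [h3, h4]
  ring

theorem memLp_comp_torusSection {d : ℕ} {ℓ : ℝ} (hℓ : 0 < ℓ) (v : L2 d ℓ) :
    MemLp (fun t : UnitAddTorus (Fin d) => (v (torusSection ℓ t) : ℂ)) 2 volume := by
  have h : MemLp (fun x => (v x : ℂ)) 2 (ENNReal.ofReal (invVol d ℓ) • cubeMeasure d ℓ) :=
    (Lp.memLp v).ofReal.smul_measure ENNReal.ofReal_ne_top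
  exact h.comp_measurePreserving (measurePreserving_torusSection hℓ)

/-- A function on the cube as a complex function on the torus. -/
def torusLift {d : ℕ} {ℓ : ℝ} (hℓ : 0 < ℓ) (v : L2 d ℓ) :
    Lp ℂ 2 (volume : Measure (UnitAddTorus (Fin d))) :=
  (memLp_comp_torusSection hℓ v).toLp _

theorem integral_comp_torusSection {d : ℕ} {ℓ : ℝ} (hℓ : 0 < ℓ) {E : Type*}
    [NormedAddCommGroup E] [NormedSpace ℝ E] {F : (Fin d → ℝ) → E}
    (hF : AEStronglyMeasurable F (cubeMeasure d ℓ)) :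
    ∫ t : UnitAddTorus (Fin d), F (torusSection ℓ t) = invVol d ℓ • ∫ x in cube d ℓ, F x := by
  have hmp := measurePreserving_torusSection (d := d) hℓ
  rw [← integral_map hmp.aemeasurable (by rw [hmp.map_eq]; exact hF.smul_measure _), hmp.map_eq,
    integral_smul_measure, ENNReal.toReal_ofReal (invVol_pos hℓ).le]

theorem normSq_mFourierCoeff_torusLift {d : ℕ} {ℓ : ℝ} (hℓ : 0 < ℓ) (v : L2 d ℓ)
    (k : Fin d → ℤ) :
    ‖mFourierCoeff (torusLift hℓ v) k‖ ^ 2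
      = invVol d ℓ ^ 2 * (cosCoeff v k ^ 2 + sinCoeff v k ^ 2) := by
  have hc : Continuous (phase ℓ k) := (contDiff_phase ℓ k).continuous
  have hneg : ∀ x, phase ℓ (-k) x = - phase ℓ k x := by
    intro x
    simp only [phase, Pi.neg_apply, ← Finset.sum_neg_distrib]
    refine Finset.sum_congr rfl fun i _ => ?_
    push_cast
    ring
  have hcos : Integrable (fun x => v x * Real.cos (phase ℓ k x)) (cubeMeasure d ℓ) :=
    integrable_mul_of_continuous v (Real.continuous_cos.comp hc)
  have hsin : Integrable (fun x => v x * Real.sin (phase ℓ k x)) (cubeMeasure d ℓ) :=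
    integrable_mul_of_continuous v (Real.continuous_sin.comp hc)
  have h1 : mFourierCoeff (torusLift hℓ v) k
      = ∫ t : UnitAddTorus (Fin d), (fun x => (((v x * Real.cos (phase ℓ k x) : ℝ) : ℂ)
        - ((v x * Real.sin (phase ℓ k x) : ℝ) : ℂ) * Complex.I)) (torusSection ℓ t) := by
    rw [mFourierCoeff]
    refine integral_congr_ae ?_
    filter_upwards [(memLp_comp_torusSection hℓ v).coeFn_toLp] with t ht
    rw [torusLift, ht, mFourier_eq_exp_phase hℓ, hneg, Complex.exp_mul_I, smul_eq_mul]
    push_cast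
    rw [Complex.cos_neg, Complex.sin_neg]
    ring
  have h2 : ∫ x in cube d ℓ, (((v x * Real.cos (phase ℓ k x) : ℝ) : ℂ)
        - ((v x * Real.sin (phase ℓ k x) : ℝ) : ℂ) * Complex.I)
      = (cosCoeff v k : ℂ) - (sinCoeff v k : ℂ) * Complex.I := by
    rw [integral_sub hcos.ofReal (hsin.ofReal.mul_const _), integral_mul_const,
      integral_complex_ofReal, integral_complex_ofReal]
    rfl
  rw [h1, integral_comp_torusSection hℓ
    (F := fun x => (((v x * Real.cos (phase ℓ k x) : ℝ) : ℂ)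
      - ((v x * Real.sin (phase ℓ k x) : ℝ) : ℂ) * Complex.I))
    (hcos.ofReal.sub (hsin.ofReal.mul_const _)).aestronglyMeasurable, h2, norm_smul, mul_pow,
    Real.norm_eq_abs, sq_abs]
  congr 1
  rw [← Complex.normSq_eq_norm_sq, Complex.normSq_apply]
  simp
  ring

theorem norm_sq_eq_integral {d : ℕ} {ℓ : ℝ} (v : L2 d ℓ) :
    ‖v‖ ^ 2 = ∫ x in cube d ℓ, v x ^ 2 := by
  rw [← real_inner_self_eq_norm_sq, L2.inner_def]
  congr 1
  ext x
  simp [sq]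

theorem hasSum_normSq_mFourierCoeff_torusLift {d : ℕ} {ℓ : ℝ} (hℓ : 0 < ℓ) (v : L2 d ℓ) :
    HasSum (fun k => ‖mFourierCoeff (torusLift hℓ v) k‖ ^ 2) (invVol d ℓ * ‖v‖ ^ 2) := by
  convert hasSum_sq_mFourierCoeff (torusLift hℓ v) using 1
  rw [norm_sq_eq_integral, ← smul_eq_mul, ← integral_comp_torusSection hℓ
    (F := fun x => v x ^ 2) ((Lp.aestronglyMeasurable v).pow 2)]
  refine integral_congr_ae ?_
  filter_upwards [(memLp_comp_torusSection hℓ v).coeFn_toLp] with t ht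
  rw [torusLift, ht, Complex.norm_real, Real.norm_eq_abs, sq_abs]

theorem gradInner_self {d : ℕ} {ℓ : ℝ} (p : PairSpace d ℓ) :
    gradInner p p = ∑ i, ‖pd i p‖ ^ 2 := by
  simp [gradInner]

theorem gradInner_self_nonneg {d : ℕ} {ℓ : ℝ} (p : PairSpace d ℓ) : 0 ≤ gradInner p p := by
  rw [gradInner_self]; positivity

theorem gradNorm_sq {d : ℕ} {ℓ : ℝ} (p : PairSpace d ℓ) : gradNorm p ^ 2 = gradInner p p :=
  Real.sq_sqrt (gradInner_self_nonneg p)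

theorem gradNorm_nonneg {d : ℕ} {ℓ : ℝ} (p : PairSpace d ℓ) : 0 ≤ gradNorm p :=
  Real.sqrt_nonneg _

theorem norm_sq_pair {d : ℕ} {ℓ : ℝ} (p : PairSpace d ℓ) :
    ‖p‖ ^ 2 = ‖fn p‖ ^ 2 + gradNorm p ^ 2 := by
  rw [gradNorm_sq, gradInner_self, WithLp.prod_norm_sq_eq_of_L2, PiLp.norm_sq_eq_of_L2]
  rfl

theorem gradNorm_le_norm {d : ℕ} {ℓ : ℝ} (p : PairSpace d ℓ) : gradNorm p ≤ ‖p‖ :=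
  le_of_abs_le <| abs_le_of_sq_le_sq (by rw [norm_sq_pair]; nlinarith [sq_nonneg ‖fn p‖]) (norm_nonneg _)

theorem norm_fn_le_norm {d : ℕ} {ℓ : ℝ} (p : PairSpace d ℓ) : ‖fn p‖ ≤ ‖p‖ :=
  le_of_abs_le <| abs_le_of_sq_le_sq (by rw [norm_sq_pair]; nlinarith [sq_nonneg (gradNorm p)]) (norm_nonneg _)

/-- Parseval's identity for the gradient. -/
theorem hasSum_freq_sq_mul_normSq {d : ℕ} {ℓ : ℝ} (hℓ : 0 < ℓ) {p : PairSpace d ℓ}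
    (hp : p ∈ H1per d ℓ) :
    HasSum (fun k : Fin d → ℤ =>
        (∑ i, (k i : ℝ) ^ 2) * ‖mFourierCoeff (torusLift hℓ (fn p)) k‖ ^ 2)
      ((ℓ / (2 * Real.pi)) ^ 2 * (invVol d ℓ * gradNorm p ^ 2)) := by
  have h := hasSum_sum (s := Finset.univ) fun i _ =>
    hasSum_normSq_mFourierCoeff_torusLift hℓ (pd i p)
  have h' := h.mul_left ((ℓ / (2 * Real.pi)) ^ 2)
  rw [← Finset.mul_sum, ← gradInner_self, ← gradNorm_sq] at h'
  refine HasSum.congr_fun h' fun k => ?_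
  rw [Finset.sum_mul, Finset.mul_sum]
  refine Finset.sum_congr rfl fun i _ => ?_
  rw [normSq_mFourierCoeff_torusLift, normSq_mFourierCoeff_torusLift,
    (hp i).cosCoeff_sq_add_sinCoeff_sq hℓ]
  have := Real.pi_pos.ne'
  field_simp

theorem norm_fn_le_gradNorm {d : ℕ} {ℓ : ℝ} (hℓ : 0 < ℓ) (v : H1perMeanZero d ℓ) :
    ‖fn v.1‖ ≤ ℓ / (2 * Real.pi) * gradNorm v.1 := by
  have hpi := Real.pi_pos
  have hc := invVol_pos (d := d) hℓ
  have h0 : mFourierCoeff (torusLift hℓ (fn v.1)) 0 = 0 := by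
    have h := normSq_mFourierCoeff_torusLift hℓ (fn v.1) 0
    have hph : ∀ x, phase ℓ (0 : Fin d → ℤ) x = 0 := fun x => by simp [phase]
    have e1 : cosCoeff (fn v.1) 0 = 0 := by
      simp only [cosCoeff, hph, Real.cos_zero, mul_one]
      exact v.2.2
    have e2 : sinCoeff (fn v.1) 0 = 0 := by
      simp [sinCoeff, hph]
    rw [e1, e2] at h
    simpa using h
  have hle : invVol d ℓ * ‖fn v.1‖ ^ 2
      ≤ (ℓ / (2 * Real.pi)) ^ 2 * (invVol d ℓ * gradNorm v.1 ^ 2) := by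
    refine hasSum_le (fun k => ?_) (hasSum_normSq_mFourierCoeff_torusLift hℓ (fn v.1))
      (hasSum_freq_sq_mul_normSq hℓ v.2.1)
    rcases eq_or_ne k 0 with rfl | hk
    · simp [h0]
    · obtain ⟨i, hi⟩ := Function.ne_iff.1 hk
      have h1 : (1 : ℝ) ≤ (k i : ℝ) ^ 2 := by
        have : (1 : ℤ) ≤ k i ^ 2 := sq_pos_of_ne_zero hi
        exact_mod_cast this
      have h2 : (k i : ℝ) ^ 2 ≤ ∑ i, (k i : ℝ) ^ 2 :=
        Finset.single_le_sum (f := fun i => (k i : ℝ) ^ 2) (fun _ _ => sq_nonneg _)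
          (Finset.mem_univ i)
      exact le_mul_of_one_le_left (sq_nonneg _) (h1.trans h2)
  refine le_of_abs_le <| abs_le_of_sq_le_sq ?_ (mul_nonneg (by positivity) (gradNorm_nonneg _))
  rw [mul_pow]
  refine le_of_mul_le_mul_left ?_ hc
  linarith

theorem exists_isPoincareConst {d : ℕ} {ℓ : ℝ} (hℓ : 0 < ℓ) : ∃ C, IsPoincareConst d ℓ C :=
  ⟨ℓ / (2 * Real.pi), by have := Real.pi_pos; positivity, norm_fn_le_gradNorm hℓ⟩

theorem exists_eLpNorm_four_le {d : ℕ} (hd : d < 4) {ℓ : ℝ} (hℓ : 0 < ℓ) :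
    ∃ K : ℝ, 0 ≤ K ∧ ∀ v : H1per d ℓ,
      eLpNorm (fn v.1) 4 (cubeMeasure d ℓ) ≤ ENNReal.ofReal (K * ‖v‖) := by
  have hc := invVol_pos (d := d) hℓ
  set S := ∑' k : Fin d → ℤ, (freqWeight k)⁻¹ ^ 2
  have hS0 : 0 ≤ S := tsum_nonneg fun _ => sq_nonneg _
  set B := √(invVol d ℓ * (1 + (ℓ / (2 * Real.pi)) ^ 2)) with hB
  have hB2 : B ^ 2 = invVol d ℓ * (1 + (ℓ / (2 * Real.pi)) ^ 2) := Real.sq_sqrt (by positivity)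
  refine ⟨(invVol d ℓ ^ (1 / 4 : ℝ))⁻¹ * (S ^ (1 / 4 : ℝ) * B), by positivity, fun v => ?_⟩
  have h1 : eLpNorm (torusLift hℓ (fn v.1)) 4 volume
      ≤ ENNReal.ofReal (S ^ (1 / 4 : ℝ) * (B * ‖v‖)) := by
    refine eLpNorm_four_le_of_mFourierCoeff hd _ (by positivity) fun F => ?_
    have hs := (hasSum_normSq_mFourierCoeff_torusLift hℓ (fn v.1)).add
      (hasSum_freq_sq_mul_normSq hℓ v.2)
    have hsum := sum_le_hasSum F (fun k _ => by positivity) hs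
    calc ∑ k ∈ F, freqWeight k * ‖mFourierCoeff (torusLift hℓ (fn v.1)) k‖ ^ 2
        = ∑ k ∈ F, (‖mFourierCoeff (torusLift hℓ (fn v.1)) k‖ ^ 2
          + (∑ i, (k i : ℝ) ^ 2) * ‖mFourierCoeff (torusLift hℓ (fn v.1)) k‖ ^ 2) :=
          Finset.sum_congr rfl fun k _ => by rw [freqWeight]; ring
      _ ≤ _ := hsum
      _ ≤ (B * ‖v‖) ^ 2 := by
        have e : ‖v‖ ^ 2 = ‖fn v.1‖ ^ 2 + gradNorm v.1 ^ 2 := norm_sq_pair v.1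
        rw [mul_pow, hB2, e]
        have i1 := mul_nonneg hc.le (sq_nonneg (gradNorm v.1))
        have i2 := mul_nonneg (mul_nonneg hc.le (sq_nonneg ‖fn v.1‖))
          (sq_nonneg (ℓ / (2 * Real.pi)))
        linarith
  have h2 : eLpNorm (torusLift hℓ (fn v.1)) 4 volume
      = ENNReal.ofReal (invVol d ℓ ^ (1 / 4 : ℝ)) * eLpNorm (fn v.1) 4 (cubeMeasure d ℓ) := by
    have hmp := measurePreserving_torusSection (d := d) hℓ
    have hae : AEStronglyMeasurable (fun x => ((fn v.1 : L2 d ℓ) x : ℂ))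
        (ENNReal.ofReal (invVol d ℓ) • cubeMeasure d ℓ) :=
      (Lp.memLp (fn v.1)).ofReal.aestronglyMeasurable.smul_measure _
    have e1 : eLpNorm (torusLift hℓ (fn v.1)) 4 volume
        = eLpNorm ((fun x => ((fn v.1 : L2 d ℓ) x : ℂ)) ∘ torusSection ℓ) 4 volume :=
      eLpNorm_congr_ae (memLp_comp_torusSection hℓ (fn v.1)).coeFn_toLp
    rw [e1, eLpNorm_comp_measurePreserving hae hmp,
      eLpNorm_smul_measure_of_ne_top (by norm_num), smul_eq_mul,
      ENNReal.ofReal_rpow_of_pos hc]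
    congr 1
    · norm_num
    · exact eLpNorm_congr_norm_ae (Filter.Eventually.of_forall fun x => Complex.norm_real _)
  have hpos : 0 < invVol d ℓ ^ (1 / 4 : ℝ) := Real.rpow_pos_of_pos hc _
  rw [h2] at h1
  rw [mul_assoc, mul_assoc, ENNReal.ofReal_mul (by positivity), ENNReal.ofReal_inv_of_pos hpos,
    mul_comm, ← div_eq_mul_inv, ENNReal.le_div_iff_mul_le (Or.inl (by simpa using hpos))
      (Or.inl ENNReal.ofReal_ne_top), mul_comm]
  exact h1

end Torus

/-! ### Hilbert space structure -/

theorem continuous_integral_mul {d : ℕ} {ℓ : ℝ} {φ : (Fin d → ℝ) → ℝ} (hφ : Continuous φ) :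
    Continuous fun v : L2 d ℓ => ∫ x in cube d ℓ, v x * φ x := by
  have h : (fun v : L2 d ℓ => ∫ x in cube d ℓ, v x * φ x)
      = fun v => inner ℝ ((memLp_of_continuous (d := d) (ℓ := ℓ) hφ).toLp φ) v := by
    ext v
    rw [L2.inner_def]
    refine integral_congr_ae ?_
    filter_upwards [(memLp_of_continuous (d := d) (ℓ := ℓ) hφ).coeFn_toLp] with x hx
    rw [hx]
    simp
  rw [h]
  fun_prop

/-- The function component of a pair, as a continuous linear map. -/
def fnL (d : ℕ) (ℓ : ℝ) : PairSpace d ℓ →L[ℝ] L2 d ℓ :=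
  LinearMap.mkContinuous
    { toFun := fn, map_add' := fun _ _ => rfl, map_smul' := fun _ _ => rfl } 1
    fun p => by rw [one_mul]; exact norm_fn_le_norm p

/-- The `i`-th component of the vector field of a pair, as a continuous linear map. -/
def pdL {d : ℕ} (ℓ : ℝ) (i : Fin d) : PairSpace d ℓ →L[ℝ] L2 d ℓ :=
  LinearMap.mkContinuous
    { toFun := pd i, map_add' := fun _ _ => rfl, map_smul' := fun _ _ => rfl } 1
    fun p => by
      rw [one_mul]
      refine le_trans ?_ (gradNorm_le_norm p)
      refine Real.le_sqrt_of_sq_le ?_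
      rw [gradInner_self]
      exact Finset.single_le_sum (f := fun i => ‖pd i p‖ ^ 2) (fun _ _ => sq_nonneg _)
        (Finset.mem_univ i)

theorem isClosed_H1perMeanZero (d : ℕ) (ℓ : ℝ) :
    IsClosed (H1perMeanZero d ℓ : Set (PairSpace d ℓ)) := by
  have h : (H1perMeanZero d ℓ : Set (PairSpace d ℓ))
      = (⋂ (i) (φ) (_ : IsPeriodicTest d ℓ φ), {p | ∫ x in cube d ℓ, fnL d ℓ p x * partialDeriv i φ x
          = -∫ x in cube d ℓ, pdL ℓ i p x * φ x})
        ∩ {p | ∫ x in cube d ℓ, fnL d ℓ p x * (fun _ => (1 : ℝ)) x = 0} := by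
    ext p
    simp only [Set.mem_inter_iff, Set.mem_iInter, Set.mem_ofPred_eq, mul_one]
    rfl
  rw [h]
  refine IsClosed.inter ?_ ?_
  · refine isClosed_iInter fun i => isClosed_iInter fun φ => isClosed_iInter fun hφ => ?_
    exact isClosed_eq ((continuous_integral_mul (hφ.continuous_partialDeriv i)).comp
      (fnL d ℓ).continuous)
      ((continuous_integral_mul hφ.1.continuous).comp (pdL ℓ i).continuous).neg
  · exact isClosed_eq ((continuous_integral_mul continuous_const).comp (fnL d ℓ).continuous)
      continuous_const

instance (d : ℕ) (ℓ : ℝ) : CompleteSpace (H1perMeanZero d ℓ) :=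
  (isClosed_H1perMeanZero d ℓ).completeSpace_coe

/-- The embedding of the mean zero Sobolev space into `L²`. -/
def fnH (d : ℕ) (ℓ : ℝ) : H1perMeanZero d ℓ →L[ℝ] L2 d ℓ :=
  (fnL d ℓ).comp (H1perMeanZero d ℓ).subtypeL

/-- The `i`-th partial derivative on the mean zero Sobolev space. -/
def pdH {d : ℕ} (ℓ : ℝ) (i : Fin d) : H1perMeanZero d ℓ →L[ℝ] L2 d ℓ :=
  (pdL ℓ i).comp (H1perMeanZero d ℓ).subtypeL

@[simp]
theorem fnH_apply {d : ℕ} {ℓ : ℝ} (v : H1perMeanZero d ℓ) : fnH d ℓ v = fn v.1 := rfl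

@[simp]
theorem pdH_apply {d : ℕ} {ℓ : ℝ} (i : Fin d) (v : H1perMeanZero d ℓ) :
    pdH ℓ i v = pd i v.1 := rfl

theorem norm_eq_zero_of_gradNorm_eq_zero {d : ℕ} {ℓ CP : ℝ} (hCP : IsPoincareConst d ℓ CP)
    {v : H1perMeanZero d ℓ} (h : gradNorm v.1 = 0) : v = 0 := by
  have h1 := hCP.2 v
  rw [h, mul_zero] at h1
  have h2 : ‖v‖ ^ 2 = ‖fn v.1‖ ^ 2 + gradNorm v.1 ^ 2 := norm_sq_pair v.1
  rw [h, le_antisymm h1 (norm_nonneg _)] at h2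
  simpa using h2

theorem IsPoincareConst.norm_sq_le {d : ℕ} {ℓ CP : ℝ} (hCP : IsPoincareConst d ℓ CP)
    (v : H1perMeanZero d ℓ) : ‖v‖ ^ 2 ≤ (1 + CP ^ 2) * gradNorm v.1 ^ 2 := by
  have h2 : ‖v‖ ^ 2 = ‖fn v.1‖ ^ 2 + gradNorm v.1 ^ 2 := norm_sq_pair v.1
  have h3 := pow_le_pow_left₀ (norm_nonneg _) (hCP.2 v) 2
  rw [h2]
  linarith [mul_pow CP (gradNorm v.1) 2]

theorem exists_solution_operator {V W : Type*} [NormedAddCommGroup V] [InnerProductSpace ℝ V]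
    [CompleteSpace V] [NormedAddCommGroup W] [InnerProductSpace ℝ W] [CompleteSpace W]
    {B : V →L[ℝ] V →L[ℝ] ℝ} (hB : IsCoercive B) (j : V →L[ℝ] W) :
    ∃ T : W →L[ℝ] V, ∀ ψ v, B (T ψ) v = inner ℝ ψ (j v) :=
  ⟨(hB.continuousLinearEquivOfBilin.symm : V →L[ℝ] V).comp (ContinuousLinearMap.adjoint j),
    fun ψ v => by
      rw [← hB.continuousLinearEquivOfBilin_apply]
      simp [ContinuousLinearMap.adjoint_inner_left]⟩

/-! ### The weighted Dirichlet form -/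

/-- The coefficient `M` is measurable and lies between two positive constants. -/
structure IsMobility {d : ℕ} (ℓ : ℝ) (M : (Fin d → ℝ) → ℝ) (M₁ M₂ : ℝ) : Prop where
  aestronglyMeasurable : AEStronglyMeasurable M (cubeMeasure d ℓ)
  pos : 0 < M₁
  bounds : ∀ᵐ x ∂cubeMeasure d ℓ, M₁ ≤ M x ∧ M x ≤ M₂

theorem isMobility_one {d : ℕ} (ℓ : ℝ) : IsMobility ℓ (fun _ : Fin d → ℝ => (1 : ℝ)) 1 1 :=
  ⟨aestronglyMeasurable_const, one_pos, Filter.Eventually.of_forall fun _ => ⟨le_rfl, le_rfl⟩⟩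

section Mobility

variable {d : ℕ} {ℓ : ℝ} {M : (Fin d → ℝ) → ℝ} {M₁ M₂ : ℝ}

theorem IsMobility.norm_bound (hM : IsMobility ℓ M M₁ M₂) :
    ∀ᵐ x ∂cubeMeasure d ℓ, ‖M x‖ ≤ M₂ := by
  filter_upwards [hM.bounds] with x hx
  rw [Real.norm_of_nonneg (hM.pos.le.trans hx.1)]
  exact hx.2

theorem IsMobility.memLp_mul (hM : IsMobility ℓ M M₁ M₂) (g : L2 d ℓ) :
    MemLp (fun x => M x * g x) 2 (cubeMeasure d ℓ) := by
  refine (Lp.memLp g).of_le_mul (c := M₂)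
    (hM.aestronglyMeasurable.mul (Lp.aestronglyMeasurable g)) ?_
  filter_upwards [hM.norm_bound] with x hx
  rw [norm_mul]
  gcongr

/-- Multiplication by the mobility on `L²`. -/
def IsMobility.mulL (hM : IsMobility ℓ M M₁ M₂) : L2 d ℓ →L[ℝ] L2 d ℓ :=
  LinearMap.mkContinuous
    { toFun := fun g => (hM.memLp_mul g).toLp _
      map_add' := fun g h => by
        refine Lp.ext ?_
        filter_upwards [(hM.memLp_mul (g + h)).coeFn_toLp, (hM.memLp_mul g).coeFn_toLp,
          (hM.memLp_mul h).coeFn_toLp, Lp.coeFn_add g h,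
          Lp.coeFn_add ((hM.memLp_mul g).toLp _) ((hM.memLp_mul h).toLp _)] with x h1 h2 h3 h4 h5
        rw [h1, h5, Pi.add_apply, h2, h3, h4, Pi.add_apply, mul_add]
      map_smul' := fun c g => by
        refine Lp.ext ?_
        filter_upwards [(hM.memLp_mul (c • g)).coeFn_toLp, (hM.memLp_mul g).coeFn_toLp,
          Lp.coeFn_smul c g, Lp.coeFn_smul c ((hM.memLp_mul g).toLp _)] with x h1 h2 h3 h4
        rw [h1, RingHom.id_apply, h4, Pi.smul_apply, h2, h3, Pi.smul_apply, smul_eq_mul,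
          smul_eq_mul]
        ring } M₂
    fun g => by
      refine Lp.norm_le_mul_norm_of_ae_le_mul ?_
      filter_upwards [(hM.memLp_mul g).coeFn_toLp, hM.norm_bound] with x h1 h2
      change ‖((hM.memLp_mul g).toLp _ : L2 d ℓ) x‖ ≤ _
      rw [h1, norm_mul]
      gcongr

theorem IsMobility.coeFn_mulL (hM : IsMobility ℓ M M₁ M₂) (g : L2 d ℓ) :
    hM.mulL g =ᵐ[cubeMeasure d ℓ] fun x => M x * g x :=
  (hM.memLp_mul g).coeFn_toLp

theorem IsMobility.inner_mulL (hM : IsMobility ℓ M M₁ M₂) (g h : L2 d ℓ) :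
    inner ℝ (hM.mulL g) h = ∫ x in cube d ℓ, M x * g x * h x := by
  rw [L2.inner_def]
  refine integral_congr_ae ?_
  filter_upwards [hM.coeFn_mulL g] with x hx
  rw [hx]
  simp [mul_comm]

theorem IsMobility.inner_mulL_comm (hM : IsMobility ℓ M M₁ M₂) (g h : L2 d ℓ) :
    inner ℝ (hM.mulL g) h = inner ℝ (hM.mulL h) g := by
  rw [hM.inner_mulL, hM.inner_mulL]
  congr 1
  ext x
  ring

theorem IsMobility.integrable_mul_mul (hM : IsMobility ℓ M M₁ M₂) (g h : L2 d ℓ) :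
    Integrable (fun x => M x * g x * h x) (cubeMeasure d ℓ) :=
  (hM.memLp_mul g).integrable_mul (Lp.memLp h)

theorem IsMobility.le_inner_mulL (hM : IsMobility ℓ M M₁ M₂) (g : L2 d ℓ) :
    M₁ * ‖g‖ ^ 2 ≤ inner ℝ (hM.mulL g) g := by
  rw [hM.inner_mulL, norm_sq_eq_integral, ← integral_const_mul]
  refine integral_mono_ae ((Lp.memLp g).integrable_sq.const_mul _) (hM.integrable_mul_mul g g) ?_
  filter_upwards [hM.bounds] with x hx
  nlinarith [mul_le_mul_of_nonneg_right hx.1 (sq_nonneg (g x))]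

theorem IsMobility.inner_mulL_le (hM : IsMobility ℓ M M₁ M₂) (g : L2 d ℓ) :
    inner ℝ (hM.mulL g) g ≤ M₂ * ‖g‖ ^ 2 := by
  rw [hM.inner_mulL, norm_sq_eq_integral, ← integral_const_mul]
  refine integral_mono_ae (hM.integrable_mul_mul g g) ((Lp.memLp g).integrable_sq.const_mul _) ?_
  filter_upwards [hM.bounds] with x hx
  nlinarith [mul_le_mul_of_nonneg_right hx.2 (sq_nonneg (g x))]

/-- The bilinear form `(M ∇u, ∇v)`. -/
def IsMobility.form (hM : IsMobility ℓ M M₁ M₂) :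
    H1perMeanZero d ℓ →L[ℝ] H1perMeanZero d ℓ →L[ℝ] ℝ :=
  ∑ i, (innerSL ℝ).bilinearComp (hM.mulL.comp (pdH ℓ i)) (pdH ℓ i)

theorem IsMobility.form_apply (hM : IsMobility ℓ M M₁ M₂) (u v : H1perMeanZero d ℓ) :
    hM.form u v = ∑ i, inner ℝ (hM.mulL (pd i u.1)) (pd i v.1) := by
  simp [IsMobility.form, sum_apply, ContinuousLinearMap.bilinearComp_apply]

theorem IsMobility.form_eq_integral (hM : IsMobility ℓ M M₁ M₂) (u v : H1perMeanZero d ℓ) :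
    hM.form u v = ∑ i, ∫ x in cube d ℓ, M x * pd i u.1 x * pd i v.1 x := by
  rw [hM.form_apply]
  exact Finset.sum_congr rfl fun i _ => hM.inner_mulL _ _

theorem IsMobility.form_comm (hM : IsMobility ℓ M M₁ M₂) (u v : H1perMeanZero d ℓ) :
    hM.form u v = hM.form v u := by
  rw [hM.form_apply, hM.form_apply]
  exact Finset.sum_congr rfl fun i _ => hM.inner_mulL_comm _ _

theorem IsMobility.le_form_self (hM : IsMobility ℓ M M₁ M₂) (v : H1perMeanZero d ℓ) :
    M₁ * gradNorm v.1 ^ 2 ≤ hM.form v v := by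
  rw [hM.form_apply, gradNorm_sq, gradInner_self, Finset.mul_sum]
  exact Finset.sum_le_sum fun i _ => hM.le_inner_mulL _

theorem IsMobility.form_self_le (hM : IsMobility ℓ M M₁ M₂) (v : H1perMeanZero d ℓ) :
    hM.form v v ≤ M₂ * gradNorm v.1 ^ 2 := by
  rw [hM.form_apply, gradNorm_sq, gradInner_self, Finset.mul_sum]
  exact Finset.sum_le_sum fun i _ => hM.inner_mulL_le _

theorem form_one_apply (u v : H1perMeanZero d ℓ) :
    (isMobility_one ℓ).form u v = gradInner u.1 v.1 := by
  rw [IsMobility.form_eq_integral, gradInner]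
  refine Finset.sum_congr rfl fun i _ => ?_
  rw [L2.inner_def]
  congr 1
  ext x
  simp [mul_comm]

theorem IsMobility.isWeakSol_iff (hM : IsMobility ℓ M M₁ M₂) (ψ : L2 d ℓ)
    (w : H1perMeanZero d ℓ) :
    IsWeakSol M ψ w ↔ ∀ v : H1perMeanZero d ℓ, hM.form w v = inner ℝ ψ (fn v.1) := by
  simp only [IsWeakSol, hM.form_eq_integral]

theorem IsMobility.isCoercive_form (hM : IsMobility ℓ M M₁ M₂) (hℓ : 0 < ℓ) :
    IsCoercive hM.form := by
  obtain ⟨CP, hCP⟩ := exists_isPoincareConst (d := d) hℓ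
  refine ⟨M₁ / (1 + CP ^ 2), div_pos hM.pos (by positivity), fun v => ?_⟩
  refine le_trans ?_ (hM.le_form_self v)
  have h := hCP.norm_sq_le v
  have hpos := hM.pos
  rw [div_mul_eq_mul_div, div_mul_eq_mul_div, div_le_iff₀ (by positivity)]
  nlinarith [mul_le_mul_of_nonneg_left h hpos.le]

theorem IsMobility.exists_solve (hM : IsMobility ℓ M M₁ M₂) (hℓ : 0 < ℓ) :
    ∃ T : L2 d ℓ →L[ℝ] H1perMeanZero d ℓ, ∀ (ψ : L2 d ℓ) (v : H1perMeanZero d ℓ),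
      hM.form (T ψ) v = inner ℝ ψ (fn v.1) := by
  have h := hM.isCoercive_form hℓ
  generalize hM.form = B at h
  exact exists_solution_operator (V := H1perMeanZero d ℓ) (W := L2 d ℓ) (B := B) h (fnH d ℓ)

/-- The solution operator of the weak problem, as a continuous linear map. -/
def IsMobility.solve (hM : IsMobility ℓ M M₁ M₂) (hℓ : 0 < ℓ) :
    L2 d ℓ →L[ℝ] H1perMeanZero d ℓ :=
  (hM.exists_solve hℓ).choose

theorem IsMobility.form_solve (hM : IsMobility ℓ M M₁ M₂) (hℓ : 0 < ℓ) (ψ : L2 d ℓ)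
    (v : H1perMeanZero d ℓ) : hM.form (hM.solve hℓ ψ) v = inner ℝ ψ (fn v.1) :=
  (hM.exists_solve hℓ).choose_spec ψ v

theorem IsMobility.isWeakSol_unique (hM : IsMobility ℓ M M₁ M₂) (hℓ : 0 < ℓ) {ψ : L2 d ℓ}
    {w z : H1perMeanZero d ℓ} (hw : IsWeakSol M ψ w) (hz : IsWeakSol M ψ z) : w = z := by
  obtain ⟨CP, hCP⟩ := exists_isPoincareConst (d := d) hℓ
  rw [hM.isWeakSol_iff] at hw hz
  have h0 : hM.form (w - z) (w - z) = 0 := by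
    rw [hM.form.map_sub, sub_apply, hw, hz, sub_self]
  have h1 := hM.le_form_self (w - z)
  rw [h0] at h1
  have h2 : gradNorm (w - z).1 ^ 2 = 0 :=
    le_antisymm (nonpos_of_mul_nonpos_right h1 hM.pos) (sq_nonneg _)
  exact sub_eq_zero.1 (norm_eq_zero_of_gradNorm_eq_zero hCP (pow_eq_zero_iff two_ne_zero |>.1 h2))

theorem IsMobility.isWeakSol_solve (hM : IsMobility ℓ M M₁ M₂) (hℓ : 0 < ℓ) (ψ : L2 d ℓ) :
    IsWeakSol M ψ (hM.solve hℓ ψ) :=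
  (hM.isWeakSol_iff ψ _).2 (hM.form_solve hℓ ψ)

theorem IsMobility.existsUnique_isWeakSol (hM : IsMobility ℓ M M₁ M₂) (hℓ : 0 < ℓ)
    (ψ : L2 d ℓ) : ∃! w, IsWeakSol M ψ w :=
  ⟨_, hM.isWeakSol_solve hℓ ψ, fun _ hz => hM.isWeakSol_unique hℓ hz (hM.isWeakSol_solve hℓ ψ)⟩

theorem IsMobility.invLap_eq_solve (hM : IsMobility ℓ M M₁ M₂) (hℓ : 0 < ℓ) (ψ : L2 d ℓ) :
    invLap M ψ = hM.solve hℓ ψ :=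
  hM.isWeakSol_unique hℓ (Classical.epsilon_spec (p := IsWeakSol M ψ) ⟨_, hM.isWeakSol_solve hℓ ψ⟩)
    (hM.isWeakSol_solve hℓ ψ)

/-- The bilinear form `((-Δ_M)⁻¹ u, v)`. -/
def IsMobility.negForm (hM : IsMobility ℓ M M₁ M₂) (hℓ : 0 < ℓ) :
    H1perMeanZero d ℓ →L[ℝ] H1perMeanZero d ℓ →L[ℝ] ℝ :=
  (innerSL ℝ).bilinearComp ((fnH d ℓ).comp ((hM.solve hℓ).comp (fnH d ℓ))) (fnH d ℓ)

theorem IsMobility.negForm_apply (hM : IsMobility ℓ M M₁ M₂) (hℓ : 0 < ℓ)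
    (u v : H1perMeanZero d ℓ) :
    hM.negForm hℓ u v = inner ℝ (fn (invLap M (fn u.1)).1) (fn v.1) := by
  rw [hM.invLap_eq_solve hℓ]
  simp [IsMobility.negForm, ContinuousLinearMap.bilinearComp_apply]

theorem IsMobility.negForm_eq_form (hM : IsMobility ℓ M M₁ M₂) (hℓ : 0 < ℓ)
    (u v : H1perMeanZero d ℓ) :
    hM.negForm hℓ u v = hM.form (hM.solve hℓ (fn u.1)) (hM.solve hℓ (fn v.1)) := by
  rw [hM.form_comm, hM.form_solve, real_inner_comm, ← hM.invLap_eq_solve, hM.negForm_apply hℓ]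

theorem IsMobility.negForm_comm (hM : IsMobility ℓ M M₁ M₂) (hℓ : 0 < ℓ)
    (u v : H1perMeanZero d ℓ) : hM.negForm hℓ u v = hM.negForm hℓ v u := by
  rw [hM.negForm_eq_form, hM.negForm_eq_form, hM.form_comm]

theorem IsMobility.form_self_nonneg (hM : IsMobility ℓ M M₁ M₂) (v : H1perMeanZero d ℓ) :
    0 ≤ hM.form v v :=
  (mul_nonneg hM.pos.le (sq_nonneg _)).trans (hM.le_form_self v)

theorem IsMobility.negForm_self_nonneg (hM : IsMobility ℓ M M₁ M₂) (hℓ : 0 < ℓ)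
    (v : H1perMeanZero d ℓ) : 0 ≤ hM.negForm hℓ v v := by
  rw [hM.negForm_eq_form]
  exact hM.form_self_nonneg _

theorem IsMobility.negNorm_sq (hM : IsMobility ℓ M M₁ M₂) (hℓ : 0 < ℓ)
    (v : H1perMeanZero d ℓ) : negNorm M (fn v.1) ^ 2 = hM.negForm hℓ v v := by
  rw [negNorm, ← hM.negForm_apply hℓ, Real.sq_sqrt (hM.negForm_self_nonneg hℓ v)]

theorem IsMobility.mul_negForm_self_le (hM : IsMobility ℓ M M₁ M₂) (hℓ : 0 < ℓ)
    (v : H1perMeanZero d ℓ) :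
    M₁ * hM.negForm hℓ v v ≤ (isMobility_one ℓ).negForm hℓ v v := by
  rw [hM.negForm_eq_form, (isMobility_one ℓ).negForm_eq_form]
  set w := hM.solve hℓ (fn v.1) with hw
  set z := (isMobility_one ℓ).solve hℓ (fn v.1) with hz
  have h0 := (isMobility_one ℓ).form_self_nonneg (M₁ • w - z)
  have h1 : (isMobility_one ℓ).form z w = hM.form w w := by
    rw [hz, hw, IsMobility.form_solve, IsMobility.form_solve]
  have h2 := hM.le_form_self w
  rw [gradNorm_sq, ← form_one_apply] at h2
  simp only [map_sub, map_smul, sub_apply, smul_apply, smul_eq_mul] at h0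
  rw [(isMobility_one ℓ).form_comm w z, h1] at h0
  nlinarith [mul_le_mul_of_nonneg_left h2 hM.pos.le]

theorem IsMobility.negForm_one_self_le (hM : IsMobility ℓ M M₁ M₂) (hℓ : 0 < ℓ) (h₂ : 0 < M₂)
    (v : H1perMeanZero d ℓ) :
    (isMobility_one ℓ).negForm hℓ v v ≤ M₂ * hM.negForm hℓ v v := by
  rw [hM.negForm_eq_form, (isMobility_one ℓ).negForm_eq_form]
  set w := hM.solve hℓ (fn v.1) with hw
  set z := (isMobility_one ℓ).solve hℓ (fn v.1) with hz
  have h0 := hM.form_self_nonneg (M₂ • w - z)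
  have h1 : hM.form w z = (isMobility_one ℓ).form z z := by
    rw [hz, hw, IsMobility.form_solve, IsMobility.form_solve]
  have h2 := hM.form_self_le z
  rw [gradNorm_sq, ← form_one_apply] at h2
  simp only [map_sub, map_smul, sub_apply, smul_apply, smul_eq_mul] at h0
  rw [hM.form_comm z w, h1] at h0
  refine le_of_mul_le_mul_left ?_ h₂
  nlinarith

end Mobility

/-! ### Quartic integrals -/

section Quartic

variable {α : Type*} [MeasurableSpace α] {μ : Measure α}

instance instHolderTripleFourFourTwo : ENNReal.HolderTriple 4 4 2 where
  inv_add_inv_eq_inv := by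
    have h : (2⁻¹ : ℝ≥0∞) = 2⁻¹ * (2⁻¹ + 2⁻¹) := by rw [ENNReal.inv_two_add_inv_two, mul_one]
    have h4 : (4 : ℝ≥0∞)⁻¹ = 2⁻¹ * 2⁻¹ := by
      rw [← ENNReal.mul_inv (by simp) (by simp)]
      norm_num
    rw [h, h4, mul_add]

theorem memLp_four_of_eLpNorm_le {f : α → ℝ} (hf : AEStronglyMeasurable f μ) {a : ℝ}
    (h : eLpNorm f 4 μ ≤ ENNReal.ofReal a) : MemLp f 4 μ :=
  ⟨hf, h.trans_lt ENNReal.ofReal_lt_top⟩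

theorem integrable_mul_four {f₁ f₂ f₃ f₄ : α → ℝ} (h₁ : MemLp f₁ 4 μ) (h₂ : MemLp f₂ 4 μ)
    (h₃ : MemLp f₃ 4 μ) (h₄ : MemLp f₄ 4 μ) :
    Integrable (fun x => f₁ x * f₂ x * (f₃ x * f₄ x)) μ :=
  (h₂.mul' (r := 2) h₁).integrable_mul (h₄.mul' (r := 2) h₃)

theorem integral_abs_mul_four_le {f₁ f₂ f₃ f₄ : α → ℝ} (h₁ : AEStronglyMeasurable f₁ μ)
    (h₂ : AEStronglyMeasurable f₂ μ) (h₃ : AEStronglyMeasurable f₃ μ)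
    (h₄ : AEStronglyMeasurable f₄ μ) {a₁ a₂ a₃ a₄ : ℝ} (ha₁ : 0 ≤ a₁) (ha₂ : 0 ≤ a₂)
    (ha₃ : 0 ≤ a₃) (ha₄ : 0 ≤ a₄) (b₁ : eLpNorm f₁ 4 μ ≤ ENNReal.ofReal a₁)
    (b₂ : eLpNorm f₂ 4 μ ≤ ENNReal.ofReal a₂) (b₃ : eLpNorm f₃ 4 μ ≤ ENNReal.ofReal a₃)
    (b₄ : eLpNorm f₄ 4 μ ≤ ENNReal.ofReal a₄) :
    ∫ x, |f₁ x * f₂ x * (f₃ x * f₄ x)| ∂μ ≤ a₁ * a₂ * (a₃ * a₄) := by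
  have i12 : eLpNorm (f₁ • f₂) 2 μ ≤ ENNReal.ofReal (a₁ * a₂) := by
    rw [ENNReal.ofReal_mul ha₁]
    exact (eLpNorm_smul_le_mul_eLpNorm (p := 4) (q := 4) h₂ h₁).trans (mul_le_mul' b₁ b₂)
  have i34 : eLpNorm (f₃ • f₄) 2 μ ≤ ENNReal.ofReal (a₃ * a₄) := by
    rw [ENNReal.ofReal_mul ha₃]
    exact (eLpNorm_smul_le_mul_eLpNorm (p := 4) (q := 4) h₄ h₃).trans (mul_le_mul' b₃ b₄)
  have i : eLpNorm ((f₁ • f₂) • (f₃ • f₄)) 1 μ ≤ ENNReal.ofReal (a₁ * a₂ * (a₃ * a₄)) := by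
    rw [ENNReal.ofReal_mul (by positivity)]
    exact (eLpNorm_smul_le_mul_eLpNorm (p := 2) (q := 2) (h₃.smul h₄) (h₁.smul h₂)).trans
      (mul_le_mul' i12 i34)
  have hn : ∫ x, |f₁ x * f₂ x * (f₃ x * f₄ x)| ∂μ
      = (eLpNorm ((f₁ • f₂) • (f₃ • f₄)) 1 μ).toReal := by
    rw [eLpNorm_one_eq_lintegral_enorm, ← integral_norm_eq_lintegral_enorm
      ((h₁.smul h₂).smul (h₃.smul h₄))]
    rfl
  rw [hn]
  exact ENNReal.toReal_le_of_le_ofReal (by positivity) i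

end Quartic

variable {d : ℕ} {ℓ : ℝ}

/-- `K` is an embedding constant into `L⁴` with respect to `q`, which is dominated by the norm. -/
structure IsQuarticBound (d : ℕ) (ℓ : ℝ) (q : H1perMeanZero d ℓ → ℝ) (K : ℝ) : Prop where
  const_nonneg : 0 ≤ K
  nonneg : ∀ v, 0 ≤ q v
  le_norm : ∀ v, q v ≤ ‖v‖
  bound : ∀ v : H1perMeanZero d ℓ,
    eLpNorm (fn v.1) 4 (cubeMeasure d ℓ) ≤ ENNReal.ofReal (K * q v)

section QuarticBound

variable {q : H1perMeanZero d ℓ → ℝ} {K : ℝ}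

theorem IsQuarticBound.memLp (hq : IsQuarticBound d ℓ q K) (v : H1perMeanZero d ℓ) :
    MemLp (fn v.1) 4 (cubeMeasure d ℓ) :=
  memLp_four_of_eLpNorm_le (Lp.aestronglyMeasurable _) (hq.bound v)

theorem IsQuarticBound.integrable (hq : IsQuarticBound d ℓ q K) (a b c e : H1perMeanZero d ℓ) :
    Integrable (fun x => fn a.1 x * fn b.1 x * (fn c.1 x * fn e.1 x)) (cubeMeasure d ℓ) :=
  integrable_mul_four (hq.memLp a) (hq.memLp b) (hq.memLp c) (hq.memLp e)

theorem IsQuarticBound.integral_abs_le (hq : IsQuarticBound d ℓ q K)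
    (a b c e : H1perMeanZero d ℓ) :
    ∫ x in cube d ℓ, |fn a.1 x * fn b.1 x * (fn c.1 x * fn e.1 x)|
      ≤ K ^ 4 * (q a * q b * (q c * q e)) := by
  have h := fun v => mul_nonneg hq.const_nonneg (hq.nonneg v)
  refine (integral_abs_mul_four_le (Lp.aestronglyMeasurable _) (Lp.aestronglyMeasurable _)
    (Lp.aestronglyMeasurable _) (Lp.aestronglyMeasurable _) (h a) (h b) (h c) (h e)
    (hq.bound a) (hq.bound b) (hq.bound c) (hq.bound e)).trans_eq ?_
  ring

/-- The functional `h ↦ ∫ v³ h`. -/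
def IsQuarticBound.cubic (hq : IsQuarticBound d ℓ q K) (v : H1perMeanZero d ℓ) :
    H1perMeanZero d ℓ →L[ℝ] ℝ :=
  LinearMap.mkContinuous
    { toFun := fun h => ∫ x in cube d ℓ, fn v.1 x * fn v.1 x * (fn v.1 x * fn h.1 x)
      map_add' := fun h k => by
        rw [← integral_add (hq.integrable v v v h) (hq.integrable v v v k)]
        refine integral_congr_ae ?_
        filter_upwards [Lp.coeFn_add (fn h.1) (fn k.1)] with x hx
        have e : fn (h + k).1 x = fn h.1 x + fn k.1 x := hx
        rw [e]
        ring
      map_smul' := fun c h => by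
        rw [RingHom.id_apply, smul_eq_mul, ← integral_const_mul]
        refine integral_congr_ae ?_
        filter_upwards [Lp.coeFn_smul c (fn h.1)] with x hx
        have e : fn (c • h).1 x = c * fn h.1 x := hx
        rw [e]
        ring }
    (K ^ 4 * (q v * q v * q v)) fun h => by
      refine (abs_integral_le_integral_abs).trans ((hq.integral_abs_le v v v h).trans ?_)
      have h1 := mul_nonneg (mul_nonneg (hq.nonneg v) (hq.nonneg v)) (hq.nonneg v)
      have h2 := mul_le_mul_of_nonneg_left (hq.le_norm h)
        (mul_nonneg (pow_nonneg hq.const_nonneg 4) h1)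
      refine le_trans (le_of_eq ?_) h2
      ring

theorem IsQuarticBound.cubic_apply (hq : IsQuarticBound d ℓ q K) (v h : H1perMeanZero d ℓ) :
    hq.cubic v h = ∫ x in cube d ℓ, fn v.1 x * fn v.1 x * (fn v.1 x * fn h.1 x) := rfl

theorem coeFn_fn_sub (u v : H1perMeanZero d ℓ) :
    ∀ᵐ x ∂cubeMeasure d ℓ, fn (u - v).1 x = fn u.1 x - fn v.1 x :=
  Lp.coeFn_sub (fn u.1) (fn v.1)

theorem coeFn_fn_add (u v : H1perMeanZero d ℓ) :
    ∀ᵐ x ∂cubeMeasure d ℓ, fn (u + v).1 x = fn u.1 x + fn v.1 x :=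
  Lp.coeFn_add (fn u.1) (fn v.1)

theorem abs_quartic_remainder_le (a b : ℝ) :
    |1 / 4 * (a + b) ^ 4 - 1 / 4 * a ^ 4 - a ^ 3 * b| ≤ 2 * (a ^ 2 * b ^ 2) + 3 / 4 * b ^ 4 := by
  have h1 := sq_nonneg (a * b + b ^ 2)
  have h2 := sq_nonneg (a * b - b ^ 2)
  have h3 := sq_nonneg (a * b)
  have h4 := sq_nonneg (b ^ 2)
  rw [abs_le]
  constructor <;> nlinarith

theorem IsQuarticBound.hasFDerivAt (hq : IsQuarticBound d ℓ q K) (v : H1perMeanZero d ℓ) :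
    HasFDerivAt (fun v : H1perMeanZero d ℓ => 1 / 4 * ∫ x in cube d ℓ, |fn v.1 x| ^ 4)
      (hq.cubic v) v := by
  rw [hasFDerivAt_iff_isLittleO_nhds_zero]
  have habs : ∀ w : H1perMeanZero d ℓ, ∫ x in cube d ℓ, |fn w.1 x| ^ 4
      = ∫ x in cube d ℓ, fn w.1 x * fn w.1 x * (fn w.1 x * fn w.1 x) := by
    intro w
    congr 1
    ext x
    rw [Even.pow_abs (by decide)]
    ring
  have hbound : ∀ h : H1perMeanZero d ℓ,
      |1 / 4 * (∫ x in cube d ℓ, |fn (v + h).1 x| ^ 4) - 1 / 4 * (∫ x in cube d ℓ, |fn v.1 x| ^ 4)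
        - hq.cubic v h| ≤ K ^ 4 * (2 * (q v ^ 2 * q h ^ 2) + 3 / 4 * q h ^ 4) := by
    intro h
    have hint : Integrable (fun x =>
        1 / 4 * (fn (v + h).1 x * fn (v + h).1 x * (fn (v + h).1 x * fn (v + h).1 x))
          - 1 / 4 * (fn v.1 x * fn v.1 x * (fn v.1 x * fn v.1 x))) (cubeMeasure d ℓ) :=
      ((hq.integrable _ _ _ _).const_mul _).sub ((hq.integrable _ _ _ _).const_mul _)
    rw [habs, habs, hq.cubic_apply, ← integral_const_mul, ← integral_const_mul,
      ← integral_sub ((hq.integrable _ _ _ _).const_mul _) ((hq.integrable _ _ _ _).const_mul _),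
      ← integral_sub hint (hq.integrable _ _ _ _)]
    have i1 := hq.integral_abs_le v v h h
    have i2 := hq.integral_abs_le h h h h
    calc _ ≤ ∫ x in cube d ℓ, (2 * |fn v.1 x * fn v.1 x * (fn h.1 x * fn h.1 x)|
          + 3 / 4 * |fn h.1 x * fn h.1 x * (fn h.1 x * fn h.1 x)|) := by
          refine abs_integral_le_integral_abs.trans (integral_mono_ae
            (hint.sub (hq.integrable _ _ _ _)).abs
            (((hq.integrable _ _ _ _).abs.const_mul _).add
              ((hq.integrable _ _ _ _).abs.const_mul _)) ?_)
          filter_upwards [coeFn_fn_add v h] with x hx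
          simp only [hx]
          refine le_trans (le_of_eq ?_) ((abs_quartic_remainder_le (fn v.1 x) (fn h.1 x)).trans
            (le_of_eq ?_))
          · congr 1; ring
          · rw [abs_of_nonneg (mul_nonneg (mul_self_nonneg _) (mul_self_nonneg _)),
              abs_of_nonneg (mul_nonneg (mul_self_nonneg _) (mul_self_nonneg _))]
            ring
      _ = 2 * (∫ x in cube d ℓ, |fn v.1 x * fn v.1 x * (fn h.1 x * fn h.1 x)|)
          + 3 / 4 * ∫ x in cube d ℓ, |fn h.1 x * fn h.1 x * (fn h.1 x * fn h.1 x)| := by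
          rw [integral_add ((hq.integrable _ _ _ _).abs.const_mul _)
            ((hq.integrable _ _ _ _).abs.const_mul _), integral_const_mul, integral_const_mul]
      _ ≤ _ := by linarith
  refine Asymptotics.IsBigO.trans_isLittleO (g := fun h : H1perMeanZero d ℓ => ‖h‖ ^ 2) ?_
    (Asymptotics.isLittleO_norm_pow_id one_lt_two)
  refine Asymptotics.IsBigO.of_bound (K ^ 4 * (2 * q v ^ 2 + 3 / 4)) ?_
  filter_upwards [Metric.ball_mem_nhds (0 : H1perMeanZero d ℓ) one_pos] with h hh
  have hh1 : ‖h‖ ≤ 1 := by simpa using (mem_ball_zero_iff.1 hh).le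
  rw [Real.norm_eq_abs, Real.norm_of_nonneg (sq_nonneg ‖h‖)]
  refine (hbound h).trans ?_
  rw [mul_assoc]
  refine mul_le_mul_of_nonneg_left ?_ (pow_nonneg hq.const_nonneg 4)
  have j1 : q h ^ 2 ≤ ‖h‖ ^ 2 := pow_le_pow_left₀ (hq.nonneg h) (hq.le_norm h) 2
  have j2 : q h ^ 2 ≤ 1 := j1.trans (pow_le_one₀ (norm_nonneg _) hh1)
  have j3 : q h ^ 4 ≤ ‖h‖ ^ 2 := by
    have := mul_le_mul j2 j1 (sq_nonneg _) zero_le_one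
    nlinarith
  nlinarith [mul_le_mul_of_nonneg_left j1 (sq_nonneg (q v))]

theorem IsQuarticBound.cubic_sub_apply (hq : IsQuarticBound d ℓ q K)
    (u v h : H1perMeanZero d ℓ) :
    (hq.cubic u - hq.cubic v) h
      = ∫ x in cube d ℓ, (|fn u.1 x| ^ 2 * fn u.1 x - |fn v.1 x| ^ 2 * fn v.1 x) * fn h.1 x := by
  rw [sub_apply, hq.cubic_apply, hq.cubic_apply,
    ← integral_sub (hq.integrable _ _ _ _) (hq.integrable _ _ _ _)]
  congr 1
  ext x
  rw [sq_abs, sq_abs]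
  ring

theorem IsQuarticBound.cubic_sub_self_nonneg (hq : IsQuarticBound d ℓ q K)
    (u v : H1perMeanZero d ℓ) : 0 ≤ (hq.cubic u - hq.cubic v) (u - v) := by
  rw [hq.cubic_sub_apply]
  refine integral_nonneg_of_ae ?_
  filter_upwards [coeFn_fn_sub u v] with x hx
  rw [hx, Pi.zero_apply, sq_abs, sq_abs]
  set a := fn u.1 x
  set b := fn v.1 x
  have e : (a ^ 2 * a - b ^ 2 * b) * (a - b)
      = (a - b) ^ 2 * (1 / 2 * a ^ 2 + 1 / 2 * b ^ 2 + 1 / 2 * (a + b) ^ 2) := by ring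
  rw [e]
  positivity

theorem IsCubicDiffConst.nonneg {C : ℝ} (hC : IsCubicDiffConst C) : 0 ≤ C := by
  have h := hC 1 0
  norm_num at h
  linarith

theorem IsQuarticBound.cubic_sub_le (hq : IsQuarticBound d ℓ q K) {C CB : ℝ}
    (hC : IsCubicDiffConst C) {u v : H1perMeanZero d ℓ} (hu : ‖u‖ ≤ CB) (hv : ‖v‖ ≤ CB)
    (h : H1perMeanZero d ℓ) :
    (hq.cubic u - hq.cubic v) h ≤ 2 * C * CB ^ 2 * K ^ 4 * (q (u - v) * q h) := by
  have hC0 := hC.nonneg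
  have i1 := hq.integral_abs_le (u - v) h u u
  have i2 := hq.integral_abs_le (u - v) h v v
  have hint : Integrable (fun x =>
      (|fn u.1 x| ^ 2 * fn u.1 x - |fn v.1 x| ^ 2 * fn v.1 x) * fn h.1 x) (cubeMeasure d ℓ) := by
    refine ((hq.integrable u u u h).sub (hq.integrable v v v h)).congr ?_
    filter_upwards with x
    rw [Pi.sub_apply, sq_abs, sq_abs]
    ring
  rw [hq.cubic_sub_apply]
  calc _ ≤ ∫ x in cube d ℓ, (C * |fn (u - v).1 x * fn h.1 x * (fn u.1 x * fn u.1 x)|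
        + C * |fn (u - v).1 x * fn h.1 x * (fn v.1 x * fn v.1 x)|) := by
        refine integral_mono_ae hint
          (((hq.integrable _ _ _ _).abs.const_mul _).add
            ((hq.integrable _ _ _ _).abs.const_mul _)) ?_
        filter_upwards [coeFn_fn_sub u v] with x hx
        rw [hx]
        refine (le_abs_self _).trans ?_
        rw [abs_mul]
        refine (mul_le_mul_of_nonneg_right (hC _ _) (abs_nonneg _)).trans_eq ?_
        simp only [abs_mul]
        ring
    _ = C * (∫ x in cube d ℓ, |fn (u - v).1 x * fn h.1 x * (fn u.1 x * fn u.1 x)|)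
        + C * ∫ x in cube d ℓ, |fn (u - v).1 x * fn h.1 x * (fn v.1 x * fn v.1 x)| := by
        rw [integral_add ((hq.integrable _ _ _ _).abs.const_mul _)
          ((hq.integrable _ _ _ _).abs.const_mul _), integral_const_mul, integral_const_mul]
    _ ≤ C * (K ^ 4 * (q (u - v) * q h * (q u * q u)))
        + C * (K ^ 4 * (q (u - v) * q h * (q v * q v))) := by gcongr
    _ ≤ C * (K ^ 4 * (q (u - v) * q h * (CB * CB)))
        + C * (K ^ 4 * (q (u - v) * q h * (CB * CB))) := by
        have hu' := (hq.le_norm u).trans hu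
        have hv' := (hq.le_norm v).trans hv
        have := hq.nonneg u
        have := hq.nonneg v
        have := hq.nonneg h
        have := hq.nonneg (u - v)
        have := hq.const_nonneg
        have : 0 ≤ CB := (norm_nonneg u).trans hu
        gcongr
    _ = _ := by ring

end QuarticBound

/-! ### Best constants -/

theorem exists_isLeast_embConst {ι : Type*} (E : ι → ℝ≥0∞) (q : ι → ℝ)
    (h : ∃ K : ℝ, 0 ≤ K ∧ ∀ v, E v ≤ ENNReal.ofReal (K * q v)) :
    ∃ C, IsLeast {K : ℝ | 0 ≤ K ∧ ∀ v, E v ≤ ENNReal.ofReal (K * q v)} C := by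
  set A := {K : ℝ | 0 ≤ K ∧ ∀ v, E v ≤ ENNReal.ofReal (K * q v)}
  have hbdd : BddBelow A := ⟨0, fun K hK => hK.1⟩
  have hcl : IsClosed A := by
    have : A = Set.Ici 0 ∩ ⋂ v, {K | E v ≤ ENNReal.ofReal (K * q v)} := by
      ext K
      simp [A]
    rw [this]
    refine isClosed_Ici.inter (isClosed_iInter fun v => ?_)
    exact isClosed_le continuous_const
      (ENNReal.continuous_ofReal.comp (continuous_id.mul continuous_const))
  exact ⟨sInf A, hcl.csInf_mem h hbdd, fun K hK => csInf_le hbdd hK⟩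

theorem exists_isBestEmbConst (hd : d < 4) (hℓ : 0 < ℓ) : ∃ C, IsBestEmbConst d ℓ C :=
  exists_isLeast_embConst _ _ (exists_eLpNorm_four_le hd hℓ)

theorem IsBestEmbConst.isQuarticBound {K : ℝ} (hK : IsBestEmbConst d ℓ K) :
    IsQuarticBound d ℓ (fun v => ‖v‖) K where
  const_nonneg := hK.1.1
  nonneg v := norm_nonneg v
  le_norm _ := le_rfl
  bound v := hK.1.2 ⟨v.1, v.2.1⟩

theorem IsBestEmbConstMeanZero.isQuarticBound {K : ℝ} (hK : IsBestEmbConstMeanZero d ℓ K) :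
    IsQuarticBound d ℓ (fun v => gradNorm v.1) K where
  const_nonneg := hK.1.1
  nonneg v := gradNorm_nonneg v.1
  le_norm v := gradNorm_le_norm v.1
  bound v := hK.1.2 v

theorem exists_isBestEmbConstMeanZero (hd : d < 4) (hℓ : 0 < ℓ) :
    ∃ C, IsBestEmbConstMeanZero d ℓ C := by
  obtain ⟨K, hK⟩ := exists_isBestEmbConst hd hℓ
  obtain ⟨CP, hCP⟩ := exists_isPoincareConst (d := d) hℓ
  refine exists_isLeast_embConst _ _ ⟨K * √(1 + CP ^ 2), mul_nonneg hK.1.1 (Real.sqrt_nonneg _),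
    fun v => (hK.isQuarticBound.bound v).trans (ENNReal.ofReal_le_ofReal ?_)⟩
  rw [mul_assoc]
  refine mul_le_mul_of_nonneg_left ?_ hK.1.1
  refine le_of_abs_le (abs_le_of_sq_le_sq ?_ (mul_nonneg (Real.sqrt_nonneg _) (gradNorm_nonneg _)))
  rw [mul_pow, Real.sq_sqrt (by positivity)]
  exact hCP.norm_sq_le v

/-! ### The derivative of the energy -/

theorem hasFDerivAt_half_quadratic {V : Type*} [NormedAddCommGroup V] [NormedSpace ℝ V]
    (A : V →L[ℝ] V →L[ℝ] ℝ) (hA : ∀ u v, A u v = A v u) (c v : V) :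
    HasFDerivAt (fun v => 1 / 2 * A (v - c) (v - c)) (A (v - c)) v := by
  have h0 : HasFDerivAt (fun v => v - c) (ContinuousLinearMap.id ℝ V) v :=
    (hasFDerivAt_id v).sub_const c
  have h := (A.hasFDerivAt_of_bilinear h0 h0).const_mul (1 / 2)
  refine h.congr_fderiv ?_
  ext w
  simp [hA w]
  ring

section Energy

variable {M : (Fin d → ℝ) → ℝ} {M₁ M₂ : ℝ} {q : H1perMeanZero d ℓ → ℝ} {K : ℝ}

theorem hasFDerivAt_energy (hM : IsMobility ℓ M M₁ M₂) (hℓ : 0 < ℓ)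
    (hq : IsQuarticBound d ℓ q K) (f : L2 d ℓ) (ustar v : H1perMeanZero d ℓ) :
    HasFDerivAt (energy M f ustar)
      (hM.negForm hℓ (v - ustar) + hq.cubic v + (isMobility_one ℓ).form v
        - (innerSL ℝ f).comp (fnH d ℓ)) v := by
  have e : energy M f ustar = fun v => 1 / 2 * hM.negForm hℓ (v - ustar) (v - ustar)
      + 1 / 4 * (∫ x in cube d ℓ, |fn v.1 x| ^ 4)
      + 1 / 2 * (isMobility_one ℓ).form (v - 0) (v - 0) - (innerSL ℝ f).comp (fnH d ℓ) v := by
    ext v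
    rw [energy, hM.negNorm_sq hℓ, gradNorm_sq, sub_zero, form_one_apply]
    simp
  have h3 := hasFDerivAt_half_quadratic (isMobility_one ℓ).form
    (isMobility_one ℓ).form_comm 0 v
  rw [sub_zero] at h3
  rw [e]
  exact (((hasFDerivAt_half_quadratic (hM.negForm hℓ) (hM.negForm_comm hℓ) ustar v).add
    (hq.hasFDerivAt v)).add h3).sub ((innerSL ℝ f).comp (fnH d ℓ)).hasFDerivAt

theorem fderiv_energy_sub_apply (hM : IsMobility ℓ M M₁ M₂) (hℓ : 0 < ℓ)
    (hq : IsQuarticBound d ℓ q K) (f : L2 d ℓ) (ustar u v h : H1perMeanZero d ℓ) :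
    (fderiv ℝ (energy M f ustar) u - fderiv ℝ (energy M f ustar) v) h
      = hM.negForm hℓ (u - v) h + (hq.cubic u - hq.cubic v) h + gradInner (u - v).1 h.1 := by
  rw [(hasFDerivAt_energy hM hℓ hq f ustar u).fderiv,
    (hasFDerivAt_energy hM hℓ hq f ustar v).fderiv, ← form_one_apply]
  simp only [map_sub, sub_apply, add_apply]
  ring

theorem differentiable_energy (hM : IsMobility ℓ M M₁ M₂) (hℓ : 0 < ℓ)
    (hq : IsQuarticBound d ℓ q K) (f : L2 d ℓ) (ustar : H1perMeanZero d ℓ) :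
    Differentiable ℝ (energy M f ustar) :=
  fun v => (hasFDerivAt_energy hM hℓ hq f ustar v).differentiableAt

theorem precondForm_self (hℓ : 0 < ℓ) (lam gam : ℝ) (v : H1perMeanZero d ℓ) :
    precondForm lam gam v v = lam * (isMobility_one ℓ).negForm hℓ v v
      + gam * ‖fn v.1‖ ^ 2 + gradNorm v.1 ^ 2 := by
  rw [precondForm, ← (isMobility_one ℓ).negForm_apply hℓ, real_inner_self_eq_norm_sq, gradNorm_sq]

theorem precondNorm_sq (hℓ : 0 < ℓ) {lam gam : ℝ} (hlam : 0 < lam) (hgam : 0 ≤ gam)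
    (v : H1perMeanZero d ℓ) :
    precondNorm lam gam v ^ 2 = lam * (isMobility_one ℓ).negForm hℓ v v
      + gam * ‖fn v.1‖ ^ 2 + gradNorm v.1 ^ 2 := by
  have h := (isMobility_one ℓ).negForm_self_nonneg hℓ v
  rw [precondNorm, precondForm_self hℓ, Real.sq_sqrt (by positivity)]

/-- Strong convexity of the energy. -/
theorem stronglyConvexWrt_energy (hM : IsMobility ℓ M M₁ M₂) (h₁₂ : M₁ ≤ M₂) (hℓ : 0 < ℓ)
    (hq : IsQuarticBound d ℓ q K) (f : L2 d ℓ) (ustar : H1perMeanZero d ℓ) {lam gam : ℝ}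
    (hlam : 0 < lam) (hgam : 0 ≤ gam) {CP r : ℝ} (hCP : IsPoincareConst d ℓ CP) (hr : 0 < r)
    (hr1 : r < 1) :
    StronglyConvexWrt (precondNorm lam gam) (convexityConst M₂ lam gam CP r)
      (energy M f ustar) := by
  have h₂ : 0 < M₂ := hM.pos.trans_le h₁₂
  have hCP0 := hCP.1
  have hpos : 0 < convexityConst M₂ lam gam CP r := by
    rw [convexityConst]
    split_ifs with hg
    · have := sub_pos.2 hr1
      exact lt_min (by positivity) (lt_min (by positivity) hr)
    · exact lt_min (by positivity) one_pos
  refine ⟨hpos, differentiable_energy hM hℓ hq f ustar, fun u v => ?_⟩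
  rw [fderiv_energy_sub_apply hM hℓ hq, ← gradNorm_sq, precondNorm_sq hℓ hlam hgam]
  have h0 := hq.cubic_sub_self_nonneg u v
  have h1 := hM.negForm_one_self_le hℓ h₂ (u - v)
  have hn := (isMobility_one ℓ).negForm_self_nonneg hℓ (u - v)
  have hP := pow_le_pow_left₀ (norm_nonneg _) (hCP.2 (u - v)) 2
  rw [mul_pow] at hP
  set n := (isMobility_one ℓ).negForm hℓ (u - v) (u - v)
  set m := hM.negForm hℓ (u - v) (u - v)
  set b := ‖fn (u - v).1‖
  set c := gradNorm (u - v).1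
  set mu := convexityConst M₂ lam gam CP r with hmu
  have hmu1 : mu ≤ 1 / (M₂ * lam) := by
    rw [hmu, convexityConst]
    split_ifs <;> exact min_le_left _ _
  have k1 : mu * (lam * n) ≤ m := by
    calc mu * (lam * n) ≤ 1 / (M₂ * lam) * (lam * n) := by gcongr
      _ = n / M₂ := by field_simp
      _ ≤ m := by rw [div_le_iff₀ h₂]; linarith
  have k2 : mu * (gam * b ^ 2) + mu * c ^ 2 ≤ c ^ 2 := by
    rcases hgam.eq_or_lt with hg | hg
    · have : mu ≤ 1 := by
        rw [hmu, convexityConst, ← hg, if_neg (lt_irrefl _)]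
        exact min_le_right _ _
      rw [← hg]
      nlinarith [sq_nonneg c]
    · have e : mu = min (1 / (M₂ * lam)) (min ((1 - r) / (gam * CP ^ 2)) r) := by
        rw [hmu, convexityConst, if_pos hg]
      have l1 : mu ≤ (1 - r) / (gam * CP ^ 2) :=
        e.trans_le ((min_le_right _ _).trans (min_le_left _ _))
      have l2 : mu ≤ r := e.trans_le ((min_le_right _ _).trans (min_le_right _ _))
      rw [le_div_iff₀ (by positivity)] at l1
      have s1 : mu * (gam * b ^ 2) ≤ mu * (gam * (CP ^ 2 * c ^ 2)) := by gcongr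
      nlinarith [sq_nonneg c, mul_le_mul_of_nonneg_right l1 (sq_nonneg c),
        mul_le_mul_of_nonneg_right l2 (sq_nonneg c)]
  linarith

theorem IsMobility.negForm_le (hM : IsMobility ℓ M M₁ M₂) (hℓ : 0 < ℓ)
    (u v : H1perMeanZero d ℓ) :
    hM.negForm hℓ u v ≤ 1 / M₁ * (√((isMobility_one ℓ).negForm hℓ u u)
      * √((isMobility_one ℓ).negForm hℓ v v)) := by
  have hcs : hM.negForm hℓ u v ^ 2 ≤ hM.negForm hℓ u u * hM.negForm hℓ v v :=
    LinearMap.BilinForm.apply_sq_le_of_symm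
      (LinearMap.mk₂ ℝ (fun u v => hM.negForm hℓ u v) (by simp) (by simp) (by simp) (by simp))
      (hM.negForm_self_nonneg hℓ) ⟨hM.negForm_comm hℓ⟩ u v
  have hu := hM.mul_negForm_self_le hℓ u
  have hv := hM.mul_negForm_self_le hℓ v
  have hu0 := hM.negForm_self_nonneg hℓ u
  have hv0 := hM.negForm_self_nonneg hℓ v
  have hu1 := (isMobility_one ℓ).negForm_self_nonneg hℓ u
  have hv1 := (isMobility_one ℓ).negForm_self_nonneg hℓ v
  have h1 := hM.pos
  refine le_of_abs_le (abs_le_of_sq_le_sq ?_ (by positivity))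
  rw [mul_pow, mul_pow, Real.sq_sqrt hu1, Real.sq_sqrt hv1]
  have h := mul_le_mul hu hv (by positivity) hu1
  have e : hM.negForm hℓ u u * hM.negForm hℓ v v
      = (1 / M₁) ^ 2 * (M₁ * hM.negForm hℓ u u * (M₁ * hM.negForm hℓ v v)) := by
    field_simp
  refine hcs.trans (e.trans_le ?_)
  gcongr

theorem norm_le_supH1 {B : Set (H1perMeanZero d ℓ)} (hB : Bornology.IsBounded B)
    {w : H1perMeanZero d ℓ} (hw : w ∈ B) : ‖w‖ ≤ supH1 B := by
  obtain ⟨C, hC⟩ := hB.exists_norm_le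
  exact le_csSup ⟨C, by rintro _ ⟨w, hw, rfl⟩; exact hC w hw⟩ ⟨w, hw, rfl⟩

theorem gradInner_le_gradNorm_mul (u v : H1perMeanZero d ℓ) :
    gradInner u.1 v.1 ≤ gradNorm u.1 * gradNorm v.1 := by
  have hcs : gradInner u.1 v.1 ^ 2 ≤ gradInner u.1 u.1 * gradInner v.1 v.1 := by
    simp only [← form_one_apply]
    exact LinearMap.BilinForm.apply_sq_le_of_symm
      (LinearMap.mk₂ ℝ (fun u v => (isMobility_one ℓ).form u v) (by simp) (by simp) (by simp)
        (by simp)) (isMobility_one ℓ).form_self_nonneg ⟨(isMobility_one ℓ).form_comm⟩ u v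
  refine le_of_abs_le (abs_le_of_sq_le_sq ?_ (mul_nonneg (gradNorm_nonneg _) (gradNorm_nonneg _)))
  rw [mul_pow, gradNorm_sq, gradNorm_sq]
  exact hcs

/-- The derivative of the energy is locally Lipschitz, provided that the seminorm in which the
quartic term is controlled is bounded by the lower order part of the preconditioner. -/
theorem locallyLipschitzDerivWrt_energy (hM : IsMobility ℓ M M₁ M₂) (hℓ : 0 < ℓ)
    (hq : IsQuarticBound d ℓ q K) (f : L2 d ℓ) (ustar : H1perMeanZero d ℓ) {lam gam : ℝ}
    (hlam : 0 < lam) (hgam : 0 ≤ gam) {C κ : ℝ} (hC : IsCubicDiffConst C) (hκ : 0 ≤ κ)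
    (hqκ : ∀ v : H1perMeanZero d ℓ, q v ^ 2 ≤ κ * (gam * ‖fn v.1‖ ^ 2 + gradNorm v.1 ^ 2)) :
    LocallyLipschitzDerivWrt (precondNorm lam gam)
      (fun B => lipConst M₁ lam C (supH1 B) (κ * K ^ 4)) (energy M f ustar) := by
  refine ⟨differentiable_energy hM hℓ hq f ustar, fun B hB _ => ?_⟩
  have h1 := hM.pos
  have hC0 := hC.nonneg
  have hK0 := hq.const_nonneg
  set L := lipConst M₁ lam C (supH1 B) (κ * K ^ 4) with hL
  have hL1 : 1 / (lam * M₁) ≤ L := le_max_left _ _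
  have hL2 : 1 + 2 * C * supH1 B ^ 2 * (κ * K ^ 4) ≤ L := le_max_right _ _
  have hL0 : 0 < L := lt_of_lt_of_le (by positivity) hL1
  refine ⟨hL0, fun u hu v hv => iSup₂_le fun w _ => ENNReal.ofReal_le_ofReal ?_⟩
  have hN : ∀ z : H1perMeanZero d ℓ, 0 ≤ precondNorm lam gam z := fun z => Real.sqrt_nonneg _
  refine div_le_of_le_mul₀ (hN w) (mul_nonneg hL0.le (hN _)) ?_
  rw [fderiv_energy_sub_apply hM hℓ hq]
  set a : H1perMeanZero d ℓ → ℝ := fun z => √((isMobility_one ℓ).negForm hℓ z z) with ha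
  set R : H1perMeanZero d ℓ → ℝ := fun z => √(gam * ‖fn z.1‖ ^ 2 + gradNorm z.1 ^ 2) with hR
  have ha0 : ∀ z, 0 ≤ a z := fun z => Real.sqrt_nonneg _
  have hR0 : ∀ z, 0 ≤ R z := fun z => Real.sqrt_nonneg _
  have hR2 : ∀ z, R z ^ 2 = gam * ‖fn z.1‖ ^ 2 + gradNorm z.1 ^ 2 := fun z =>
    Real.sq_sqrt (by positivity)
  have hNsq : ∀ z, precondNorm lam gam z ^ 2 = lam * a z ^ 2 + R z ^ 2 := fun z => by
    rw [precondNorm_sq hℓ hlam hgam, hR2, ha,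
      Real.sq_sqrt ((isMobility_one ℓ).negForm_self_nonneg hℓ z)]
    ring
  have hgR : ∀ z : H1perMeanZero d ℓ, gradNorm z.1 ≤ R z := fun z => by
    refine Real.le_sqrt_of_sq_le ?_
    have : 0 ≤ gam * ‖fn z.1‖ ^ 2 := by positivity
    linarith
  have hqR : ∀ z, q z ≤ √κ * R z := fun z => by
    refine le_of_abs_le (abs_le_of_sq_le_sq ?_ (mul_nonneg (Real.sqrt_nonneg _) (hR0 z)))
    rw [mul_pow, Real.sq_sqrt hκ, hR2]
    exact hqκ z
  set e := u - v
  have t1 : hM.negForm hℓ e w ≤ L * (lam * (a e * a w)) := by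
    refine (hM.negForm_le hℓ e w).trans ?_
    have : 1 / M₁ * (a e * a w) = 1 / (lam * M₁) * (lam * (a e * a w)) := by field_simp
    rw [← ha] at *
    refine this.trans_le (mul_le_mul_of_nonneg_right hL1 ?_)
    have := ha0 e
    have := ha0 w
    positivity
  have t2 : (hq.cubic u - hq.cubic v) w
      ≤ 2 * C * supH1 B ^ 2 * (κ * K ^ 4) * (R e * R w) := by
    refine (hq.cubic_sub_le hC (norm_le_supH1 hB hu) (norm_le_supH1 hB hv) w).trans ?_
    have hqq : q e * q w ≤ κ * (R e * R w) := by
      refine (mul_le_mul (hqR e) (hqR w) (hq.nonneg w)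
        (mul_nonneg (Real.sqrt_nonneg _) (hR0 e))).trans_eq ?_
      rw [mul_mul_mul_comm, Real.mul_self_sqrt hκ]
    have hco : 0 ≤ 2 * C * supH1 B ^ 2 * K ^ 4 := by positivity
    refine (mul_le_mul_of_nonneg_left hqq hco).trans_eq ?_
    ring
  have t3 : gradInner e.1 w.1 ≤ R e * R w :=
    (gradInner_le_gradNorm_mul e w).trans (mul_le_mul (hgR e) (hgR w) (gradNorm_nonneg _) (hR0 e))
  have hcs : lam * (a e * a w) + R e * R w ≤ precondNorm lam gam e * precondNorm lam gam w := by
    refine le_of_abs_le (abs_le_of_sq_le_sq ?_ (mul_nonneg (hN e) (hN w)))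
    rw [mul_pow, hNsq, hNsq]
    nlinarith [mul_nonneg hlam.le (sq_nonneg (a e * R w - a w * R e))]
  have t4 : (1 + 2 * C * supH1 B ^ 2 * (κ * K ^ 4)) * (R e * R w) ≤ L * (R e * R w) :=
    mul_le_mul_of_nonneg_right hL2 (mul_nonneg (hR0 e) (hR0 w))
  calc _ ≤ L * (lam * (a e * a w) + R e * R w) := by linarith
    _ ≤ L * (precondNorm lam gam e * precondNorm lam gam w) :=
      mul_le_mul_of_nonneg_left hcs hL0.le
    _ = _ := by ring

end Energy

end CahnHilliard

end

open CahnHilliard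
theorem lemma4p1 (d : ℕ) (hd : d = 2 ∨ d = 3) (ℓ : ℝ) (hℓ : 0 < ℓ)
    (M : (Fin d → ℝ) → ℝ) (hM : AEStronglyMeasurable M (cubeMeasure d ℓ))
    (M₁ M₂ : ℝ) (hM₁ : 0 < M₁) (hM₁₂ : M₁ ≤ M₂)
    (hMbd : ∀ x ∈ cube d ℓ, M₁ ≤ M x ∧ M x ≤ M₂)
    (f : L2 d ℓ) (ustar : H1perMeanZero d ℓ)
    (lam gam : ℝ) (hlam : 0 < lam) (hgam : 0 ≤ gam) :
    -- the objects that enter the energy, the norm and the constants are well defined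
    ((∀ ψ : L2 d ℓ, ∃! w, IsWeakSol M ψ w) ∧
      (∀ ψ : L2 d ℓ, ∃! w, IsWeakSol (fun _ => 1) ψ w) ∧
      (∃ CP, IsPoincareConst d ℓ CP) ∧
      (∃ C, IsBestEmbConst d ℓ C) ∧
      (∃ C, IsBestEmbConstMeanZero d ℓ C)) ∧
    -- strong convexity
    (∀ CP r : ℝ, IsPoincareConst d ℓ CP → 0 < r → r < 1 →
      StronglyConvexWrt (precondNorm lam gam) (convexityConst M₂ lam gam CP r)
        (energy M f ustar)) ∧
    -- locally Lipschitz derivative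
    (∀ C₃ : ℝ, IsCubicDiffConst C₃ →
      (∀ K : ℝ, IsBestEmbConstMeanZero d ℓ K →
        LocallyLipschitzDerivWrt (precondNorm lam gam)
          (fun B => lipConst M₁ lam C₃ (supH1 B) (K ^ 4)) (energy M f ustar)) ∧
      (∀ CP K : ℝ, IsPoincareConst d ℓ CP → IsBestEmbConst d ℓ K →
        LocallyLipschitzDerivWrt (precondNorm lam gam)
          (fun B => lipConst M₁ lam C₃ (supH1 B)
            ((if 1 ≤ gam then 1 else 1 + CP ^ 2) * K ^ 4)) (energy M f ustar))) := by
  have hd4 : d < 4 := by omega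
  have hmob : IsMobility ℓ M M₁ M₂ :=
    ⟨hM, hM₁, (ae_restrict_mem (MeasurableSet.univ_pi fun _ => measurableSet_Ioo)).mono
      fun x hx => hMbd x hx⟩
  obtain ⟨K₀, hK₀⟩ := exists_isBestEmbConst hd4 hℓ
  refine ⟨⟨hmob.existsUnique_isWeakSol hℓ, (isMobility_one ℓ).existsUnique_isWeakSol hℓ,
    exists_isPoincareConst hℓ, ⟨K₀, hK₀⟩, exists_isBestEmbConstMeanZero hd4 hℓ⟩,
    fun CP r hCP hr hr1 => stronglyConvexWrt_energy hmob hM₁₂ hℓ hK₀.isQuarticBound f ustar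
      hlam hgam hCP hr hr1,
    fun C₃ hC₃ => ⟨fun K hK => ?_, fun CP K hCP hK => ?_⟩⟩
  · have h := locallyLipschitzDerivWrt_energy hmob hℓ hK.isQuarticBound f ustar hlam hgam hC₃
      zero_le_one fun v => by
        have : 0 ≤ gam * ‖fn v.1‖ ^ 2 := by positivity
        linarith
    simpa only [one_mul] using h
  · refine locallyLipschitzDerivWrt_energy hmob hℓ hK.isQuarticBound f ustar hlam hgam hC₃
      (by split_ifs <;> positivity) fun v => ?_
    split_ifs with hg
    · have h2 : ‖v‖ ^ 2 = ‖fn v.1‖ ^ 2 + gradNorm v.1 ^ 2 := norm_sq_pair v.1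
      have := mul_le_mul_of_nonneg_right hg (sq_nonneg ‖fn v.1‖)
      linarith
    · have h2 := hCP.norm_sq_le v
      have : 0 ≤ (1 + CP ^ 2) * (gam * ‖fn v.1‖ ^ 2) := by positivity
      linarith
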